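/- \textbf{Setting.} Let $\mathcal L=(\mathbb Z/L)^d$ be the periodic lattice of width $L\ge 1$. It carries a metric $D$ and a neighborhood map $A(\cdot)$ such that, for some $A\ge 1$, every site has exactly $A$ neighbors and is a neighbor of exactly $A$ sites. A \emph{free} packet (one that is never delayed by other packets) travelling from $\mathbf x$ to $\mathbf z$ moves, in unit time and as long as it is not at $\mathbf z$, from its site $\mathbf y$ to a uniformly chosen element of the set of those neighbors of $\mathbf y$ that are nearest to $\mathbf z$ in the metric $D$. The \emph{free delay} $\bar\tau_0$ is its expected travel time, averaged over independent uniformly distributed $\mathbf x,\mathbf z\in\mathcal L$. For $\lambda>0$ consider the open Jackson network on $\mathcal L$ with independent Poisson inputs of rate $\lambda$ at every site, a single first-in-first-out server with exponential service times of rate $\mu=1$ at every site, and a Markovian routing which does not depend on $\lambda$: a packet served at $\mathbf y$ is forwarded to $\mathbf x$ with probability $r_{\mathbf{yx}}$ and leaves the network with probability $r_{\mathbf y,\infty}=1-\sum_{\mathbf x}r_{\mathbf{yx}}$. The network is \emph{stable} if the law of its queue lengths converges, from every initial configuration and to the same limit, to a probability distribution as $t\to\infty$; this limit is the \emph{stable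 state}. A \emph{site traffic} is a solution $(\sigma(\mathbf x))_{\mathbf x\in\mathcal L}$ of the traffic equations $\sigma(\mathbf x)=\lambda+\sum_{\mathbf y}\sigma(\mathbf y)\,r_{\mathbf{yx}}$. \textbf{Mean-field assumptions.} (1) Isotropy: $r_{\mathbf{yx}}=\frac1A(1-r_{\mathbf y,\infty})$ if $\mathbf x\in A(\mathbf y)$, and $r_{\mathbf{yx}}=0$ otherwise. (2) Homogeneity: $r_{\mathbf y,\infty}=r_\infty$ for all $\mathbf y$, where $r_\infty>0$. (3) Mean-field lifetime relation: for every $\lambda>0$ for which the network is stable, the mean lifetime $\bar\tau$ of a packet that enters the network in the stable state, at a uniformly distributed site, equals the expected value of the sum of $1+\bar q(\mathbf y)$ over the sites $\mathbf y$ from which a free packet hops on its way from a uniformly distributed source to an independent, uniformly distributed destination. Here $\bar q(\mathbf y)$ is the mean queue length at $\mathbf y$ in the stable state. (If $\bar q(\mathbf y)=\bar q$ for all $\mathbf y$, this reads $\bar\tau=\bar\tau_0(1+\bar q)$.) \textbf{Corollary.} Under these assumptions the leaving probability is $$r_\infty=\frac1{\bar\tau_0};$$ for every $\lambda>0$ the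 unique site traffic is the constant $$\sigma(\mathbf x)=\sigma=\lambda\bar\tau_0\qquad(\mathbf x\in\mathcal L);$$ and for every $\lambda>0$ the network is stable if and only if $$\lambda<\frac1{\bar\tau_0}.$$ That is, the critical input traffic, the least upper bound $\lambda_c$ of the set of those $\lambda>0$ for which the network is stable, is $\lambda_c=1/\bar\tau_0$. -/

import Mathlib

open Filter Topology MeasureTheory
open scoped ENNReal

noncomputable section

/-! ## Continuous-time Markov chains with finitely many kinds of events

`rate e` is the rate of the (exponential) clock of event `e`, and `act e s` the state reached
from `s` when that clock rings. -/

/-- The generator `G f (s) = ∑ₑ rate e * (f (act e s) - f s)`. -/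
def ctmcGenerator {S E : Type*} [Fintype E] (rate : E → ℝ) (act : E → S → S)
    (f : S → ℝ) : S → ℝ :=
  fun s => ∑ e, rate e * (f (act e s) - f s)

/-- The transition semigroup `exp (t G)`, i.e. `f ↦ (s ↦ E[f(X_t) | X_0 = s])`. It is applied
to bounded `f` only; the total rate being finite, the exponential series converges absolutely. -/
def ctmcSemigroup {S E : Type*} [Fintype E] (rate : E → ℝ) (act : E → S → S)
    (t : ℝ) (f : S → ℝ) (s : S) : ℝ :=
  ∑' k : ℕ, t ^ k / (k.factorial : ℝ) * ((ctmcGenerator rate act)^[k] f) s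

/-! ## Open Jackson networks -/

/-- Markovian routing on a finite set of sites: after being served at `y`, a packet joins the
queue of `x` with probability `route y x` and leaves the network with probability `leave y`. -/
structure Routing (V : Type*) [Fintype V] where
  route : V → V → ℝ
  leave : V → ℝ
  route_nonneg : ∀ y x, 0 ≤ route y x
  leave_nonneg : ∀ y, 0 ≤ leave y
  sum_route : ∀ y, ∑ x, route y x = 1 - leave y

/-- An open Jackson network: independent Poisson inputs of rate `input x`, one FIFO server with
exponential service times of rate `service x` at each site, and Markovian routing. -/
structure JacksonNetwork (V : Type*) [Fintype V] extends Routing V where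
  input : V → ℝ
  service : V → ℝ
  input_nonneg : ∀ x, 0 ≤ input x
  service_pos : ∀ x, 0 < service x

/-- The events of a Jackson network: `inl x` is an external arrival at `x`; `inr (y, some x)` is
a service completion at `y` after which the served packet is forwarded to `x`; `inr (y, none)` is
a service completion at `y` after which the served packet leaves the network. -/
abbrev NetEvent (V : Type*) : Type _ := V ⊕ (V × Option V)

section Queues

variable {V : Type*} [DecidableEq V]

/-- One more packet in the queue of `x`. -/
def addPacket (n : V → ℕ) (x : V) : V → ℕ := Function.update n x (n x + 1)

/-- One packet fewer in the queue of `y`. -/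
def removePacket (n : V → ℕ) (y : V) : V → ℕ := Function.update n y (n y - 1)

/-- Effect of an event on the queue lengths (nothing happens at an empty queue). -/
def queueAct : NetEvent V → (V → ℕ) → (V → ℕ)
  | Sum.inl x, n => addPacket n x
  | Sum.inr (y, none), n => if n y = 0 then n else removePacket n y
  | Sum.inr (y, some x), n => if n y = 0 then n else addPacket (removePacket n y) x

/-- Effect of an event on the queue lengths together with one tagged packet. The mark
`some (i, p)` says that the tagged packet is in the queue of `i` with `p` packets ahead of it;
the mark `none` says that it has left the network. Queues are first-in-first-out. -/
def taggedAct : NetEvent V → (V → ℕ) × Option (V × ℕ) → (V → ℕ) × Option (V × ℕ)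
  | e, (n, none) => (queueAct e n, none)
  | Sum.inl x, (n, some a) => (queueAct (Sum.inl x) n, some a)
  | Sum.inr (y, o), (n, some (i, p)) =>
      (queueAct (Sum.inr (y, o)) n,
        if y ≠ i then some (i, p)
        else if p ≠ 0 then some (i, p - 1)
        else o.map fun x => (x, removePacket n y x))

end Queues

namespace JacksonNetwork

variable {V : Type*} [Fintype V] [DecidableEq V]

/-- Rates of the events. -/
def eventRate (N : JacksonNetwork V) : NetEvent V → ℝ
  | Sum.inl x => N.input x
  | Sum.inr (y, none) => N.service y * N.leave y
  | Sum.inr (y, some x) => N.service y * N.route y x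

/-- Probability that the queue lengths are `m` at time `t` if they are `n` at time `0`. -/
def transitionProb (N : JacksonNetwork V) (t : ℝ) (n m : V → ℕ) : ℝ :=
  ctmcSemigroup N.eventRate queueAct t (Set.indicator {m} 1) n

/-- `P` is the stable state: the law of the queue lengths converges to the probability
distribution `P` from every initial condition. -/
def IsStableState (N : JacksonNetwork V) (P : PMF (V → ℕ)) : Prop :=
  ∀ n m : V → ℕ, Tendsto (fun t : ℝ => N.transitionProb t n m) atTop (𝓝 (P m).toReal)

/-- The network converges to a stable state. -/
def IsStable (N : JacksonNetwork V) : Prop := ∃ P : PMF (V → ℕ), N.IsStableState P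

/-- `s` is a site traffic: a solution of the traffic equations. -/
def IsSiteTraffic (N : JacksonNetwork V) (s : V → ℝ) : Prop :=
  ∀ x, s x = N.input x + ∑ y, s y * N.route y x

/-- Probability that a packet which enters the network at the site `x`, finding the queue lengths
`n` there, is still in the network a time `t` later. -/
def lifetimeTail (N : JacksonNetwork V) (n : V → ℕ) (x : V) (t : ℝ) : ℝ :=
  ctmcSemigroup N.eventRate taggedAct t (fun s => if s.2.isSome then 1 else 0)
    (addPacket n x, some (x, n x))

/-- Mean lifetime `∫₀^∞ P(lifetime > t) dt` of a packet that enters the network when the queue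
lengths have law `P`; it enters at `x` with probability proportional to the input rate at `x`. -/
def meanLifetime (N : JacksonNetwork V) (P : PMF (V → ℕ)) : ℝ≥0∞ :=
  ∫⁻ t in Set.Ioi (0 : ℝ), ∑' n : V → ℕ, P n *
    ∑ x, ENNReal.ofReal (N.input x / ∑ y, N.input y) * ENNReal.ofReal (N.lifetimeTail n x t)

end JacksonNetwork

/-- Mean queue length at the site `x` when the queue lengths have law `P`. -/
def meanQueue {V : Type*} (P : PMF (V → ℕ)) (x : V) : ℝ≥0∞ :=
  ∑' n : V → ℕ, P n * (n x : ℝ≥0∞)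

/-- The open Jackson network with the given routing, input rate `lam` at every site, and service
rate `1` at every site. -/
def Routing.network {V : Type*} [Fintype V] (R : Routing V) (lam : ℝ) (hlam : 0 < lam) :
    JacksonNetwork V where
  toRouting := R
  input := fun _ => lam
  service := fun _ => 1
  input_nonneg := fun _ => hlam.le
  service_pos := fun _ => one_pos

/-- The set of the input traffics for which the network converges to a stable state. -/
def Routing.stableTraffics {V : Type*} [Fintype V] [DecidableEq V] (R : Routing V) : Set ℝ :=
  {lam | ∃ hlam : 0 < lam, (R.network lam hlam).IsStable}

/-- Isotropy: a site forwards its packets with equal probabilities to its neighbours (and to no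
other site). -/
def Routing.IsIsotropic {V : Type*} [Fintype V] (R : Routing V) (A : V → Finset V) : Prop :=
  ∀ y x, (x ∈ A y → R.route y x = 1 / ((A y).card : ℝ) * (1 - R.leave y)) ∧
    (x ∉ A y → R.route y x = 0)

/-- Homogeneity: the leaving probability is the same at all sites. -/
def Routing.IsHomogeneous {V : Type*} [Fintype V] (R : Routing V) (rInf : ℝ) : Prop :=
  ∀ y, R.leave y = rInf

/-! ## The lattice model and its free delay -/

/-- The sites of the `d`-dimensional periodic lattice of width `L`. -/
abbrev Site (d L : ℕ) : Type := Fin d → ZMod L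

/-- A packet network on the periodic lattice: a neighbourhood of each site, and a metric that is
used for routing. All sites have the same number of neighbours, and, the sites being identical
in topology, each site is a neighbour of equally many sites. -/
structure LatticeModel (d L : ℕ) [NeZero L] where
  nbhd : Site d L → Finset (Site d L)
  degree : ℕ
  degree_pos : 0 < degree
  card_nbhd : ∀ x, (nbhd x).card = degree
  card_inNbhd : ∀ x, (Finset.univ.filter fun y => x ∈ nbhd y).card = degree
  metric : Site d L → Site d L → ℝ
  metric_eq_zero : ∀ x y, metric x y = 0 ↔ x = y
  metric_symm : ∀ x y, metric x y = metric y x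
  metric_triangle : ∀ x y z, metric x z ≤ metric x y + metric y z

namespace LatticeModel

variable {d L : ℕ} [NeZero L]

open Classical in
/-- The neighbours of `x` that are nearest to the destination `z`. -/
def nearest (M : LatticeModel d L) (z x : Site d L) : Finset (Site d L) :=
  (M.nbhd x).filter fun y => ∀ w ∈ M.nbhd x, M.metric z y ≤ M.metric z w

/-- Expected cost of the first `k` hops of a free packet on its way from `x` to `z`, where each
hop out of a site `y` costs `c y`. A free packet meets no other packets, so that its next hop is
uniformly distributed among all the neighbours nearest to the destination; it leaves on reaching
the destination. -/
def hopCost (M : LatticeModel d L) (c : Site d L → ℝ≥0∞) (z : Site d L) :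
    ℕ → Site d L → ℝ≥0∞
  | 0, _ => 0
  | k + 1, x =>
      if x = z then 0
      else c x + (∑ y ∈ M.nearest z x, M.hopCost c z k y) / ((M.nearest z x).card : ℝ≥0∞)

/-- Expected total of `c` over the sites at which a free packet is queued on its way, averaged
over independent, uniformly distributed sources and destinations. -/
def meanRouteCost (M : LatticeModel d L) (c : Site d L → ℝ≥0∞) : ℝ≥0∞ :=
  (∑ x, ∑ z, ⨆ k, M.hopCost c z k x) / (Fintype.card (Site d L) : ℝ≥0∞) ^ 2

/-- Average free delay: one unit of service time at each site of the way, and no waiting. -/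
def freeDelay (M : LatticeModel d L) : ℝ≥0∞ := M.meanRouteCost fun _ => 1

/-- The mean-field lifetime relation in the stable state `P` of a queueing network `N` on the
lattice: the mean lifetime of a packet is what one obtains when, on the way of a packet, each
queue is given its average length, so that passing through the site `x` takes one unit of time
for the packet itself and one for each of the packets queued there. -/
def MeanFieldLifetime (M : LatticeModel d L) (N : JacksonNetwork (Site d L))
    (P : PMF (Site d L → ℕ)) : Prop :=
  N.meanLifetime P = M.meanRouteCost fun x => 1 + meanQueue P x

end LatticeModel

end

/-! Isotropy and the equality of in- and out-degree make the routing matrix have all row and column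
sums equal to `1 - r`, where `r = rInf`. The constant `lam / r` therefore solves the traffic
equations, uniquely because routing contracts the l¹ norm by `1 - r < 1`. For `lam < r` the product
of geometric laws of ratio `lam / r` is stationary, the mean queue is `q = lam / (r - lam)`, and
Little's law gives the mean lifetime `q / lam = 1 / (r - lam)`. The lifetime relation becomes `1 /
(r - lam) = τ₀ (1 + q) = τ₀ r / (r - lam)`, so that `τ₀ = 1 / r`. It remains to establish the
queueing facts for the actual process.

The total jump rate is finite, so the semigroup is the exponential of a bounded operator on bounded
functions. Three limits at infinity rest on one principle: if a function converges and its second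
derivative is bounded, its derivative tends to zero (`tendsto_deriv_zero_of_tendsto`).

Convergence: under a stationary law the second moment of `u t = exp (t G) f` decreases, at the rate
of the mean squared jumps of `u t`. Hence `u t` flattens across every possible jump; arrivals
connect all states to the empty one, and the stationary mean of `u t` is conserved, so `u t` tends
to that mean (`isStableState_of_productForm`).

Instability: a stable state satisfies global balance against finitely supported functions. Testing
with truncations of the total queue length equates the input with the mean output. The output falls
short of the full capacity because the empty state has positive probability (`sum_input_lt`).

Little's law: summing a function of a tagged packet over all packets present intertwines the tagged
and untagged generators up to an arrival term (`packetSum_ctmcGenerator`). The mean number of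
initially present packets still there at time `t` thus has derivative `-(∑ input) * P(lifetime >
t)`; integrating over time gives the law, once this number is shown to tend to zero. -/

noncomputable section

/-! ### Exponentials of bounded operators. -/

section OperatorSemigroup

variable {F : Type*} [NormedAddCommGroup F] [NormedSpace ℝ F]

/-- The operator semigroup `exp (t G)` of a bounded operator `G`. -/
def expSemigroup (G : F →L[ℝ] F) (t : ℝ) : F →L[ℝ] F := NormedSpace.exp (t • G)

theorem hasSum_expSemigroup [CompleteSpace F] (G : F →L[ℝ] F) (t : ℝ) (f : F) (l : F →L[ℝ] ℝ) :
    HasSum (fun k : ℕ => t ^ k / (k.factorial : ℝ) * l ((G ^ k) f)) (l (expSemigroup G t f)) := by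
  have h := (NormedSpace.exp_series_hasSum_exp' (𝕂 := ℝ) (t • G)).mapL
    (l.comp (ContinuousLinearMap.apply ℝ F f))
  refine h.congr_fun ?_
  intro k
  simp [smul_pow]
  ring

theorem commute_expSemigroup (G : F →L[ℝ] F) (t : ℝ) (f : F) :
    G (expSemigroup G t f) = expSemigroup G t (G f) := by
  have hc : Commute G (NormedSpace.exp (t • G)) := ((Commute.refl _).smul_right t).exp_right
  exact congr($(hc.eq) f)

theorem hasDerivAt_expSemigroup [CompleteSpace F] (G : F →L[ℝ] F) (t : ℝ) (f : F) (l : F →L[ℝ] ℝ) :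
    HasDerivAt (fun t => l (expSemigroup G t f)) (l (expSemigroup G t (G f))) t :=
  (l.comp (ContinuousLinearMap.apply ℝ F f)).hasFDerivAt.comp_hasDerivAt t
    (hasDerivAt_exp_smul_const G t)

/-- Uniformization: a scalar commutes with everything, so the negative diagonal part of a generator
only contributes a positive factor, leaving the exponential of a positive operator. -/
theorem expSemigroup_sub_smul_one [CompleteSpace F] (K : F →L[ℝ] F) (c t : ℝ) :
    expSemigroup (K - c • 1) t = Real.exp (-(t * c)) • expSemigroup K t := by
  let _ : NormedAlgebra ℚ (F →L[ℝ] F) := .restrictScalars ℚ ℝ _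
  have h : t • (K - c • (1 : F →L[ℝ] F)) = t • K + algebraMap ℝ (F →L[ℝ] F) (-(t * c)) := by
    rw [Algebra.algebraMap_eq_smul_one, smul_sub, smul_smul, neg_smul, sub_eq_add_neg]
  rw [expSemigroup, h, NormedSpace.exp_add_of_commute (Algebra.commutes _ _).symm,
    ← NormedSpace.algebraMap_exp_comm, ← Real.exp_eq_exp_ℝ, Algebra.algebraMap_eq_smul_one,
    mul_smul_comm, mul_one, expSemigroup]

end OperatorSemigroup

/-! ### The transition semigroup: positivity, contraction and the Kolmogorov equations. -/

section Semigroup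

variable {S E : Type*} [Fintype E]

section Operator

open scoped BoundedContinuousFunction

variable [TopologicalSpace S] [DiscreteTopology S]

/-- The operator `f ↦ ∑ₑ rate e * f (act e ·)` on bounded functions. -/
def ctmcJumpOp (rate : E → ℝ) (act : E → S → S) : (S →ᵇ ℝ) →L[ℝ] (S →ᵇ ℝ) :=
  ∑ e, rate e • BoundedContinuousFunction.compContinuousCLM ℝ ℝ
    ⟨act e, continuous_of_discreteTopology⟩

/-- The generator as a bounded operator on bounded functions. -/
def ctmcGenOp (rate : E → ℝ) (act : E → S → S) : (S →ᵇ ℝ) →L[ℝ] (S →ᵇ ℝ) :=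
  ctmcJumpOp rate act - (∑ e, rate e) • 1

theorem ctmcJumpOp_apply (rate : E → ℝ) (act : E → S → S) (f : S →ᵇ ℝ) (s : S) :
    ctmcJumpOp rate act f s = ∑ e, rate e * f (act e s) := by
  simp [ctmcJumpOp]

theorem coe_ctmcGenOp (rate : E → ℝ) (act : E → S → S) (f : S →ᵇ ℝ) :
    ⇑(ctmcGenOp rate act f) = ctmcGenerator rate act f := by
  ext s
  simp [ctmcGenOp, ctmcJumpOp_apply, ctmcGenerator, mul_sub, Finset.sum_sub_distrib,
    Finset.sum_mul]

theorem coe_ctmcGenOp_pow (rate : E → ℝ) (act : E → S → S) (f : S →ᵇ ℝ) (k : ℕ) :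
    ⇑((ctmcGenOp rate act ^ k) f) = (ctmcGenerator rate act)^[k] f := by
  induction k with
  | zero => simp
  | succ k ih =>
    rw [pow_succ', Function.iterate_succ_apply', ← ih, ← coe_ctmcGenOp]
    rfl

theorem ctmcSemigroup_eq_exp (rate : E → ℝ) (act : E → S → S) (t : ℝ) (f : S →ᵇ ℝ) (s : S) :
    ctmcSemigroup rate act t f s = expSemigroup (ctmcGenOp rate act) t f s := by
  refine Eq.trans ?_ (hasSum_expSemigroup (ctmcGenOp rate act) t f
    (BoundedContinuousFunction.evalCLM ℝ s)).tsum_eq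
  simp [ctmcSemigroup, ← coe_ctmcGenOp_pow]

theorem expSemigroup_ctmcJumpOp_nonneg {rate : E → ℝ} (hrate : ∀ e, 0 ≤ rate e)
    (act : E → S → S) {t : ℝ} (ht : 0 ≤ t) {f : S →ᵇ ℝ} (hf : ∀ s, 0 ≤ f s) (s : S) :
    0 ≤ expSemigroup (ctmcJumpOp rate act) t f s := by
  refine (hasSum_expSemigroup (ctmcJumpOp rate act) t f
    (BoundedContinuousFunction.evalCLM ℝ s)).nonneg fun k => mul_nonneg (by positivity) ?_
  rw [BoundedContinuousFunction.evalCLM_apply]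
  induction k generalizing s with
  | zero => exact hf s
  | succ k ih =>
    rw [pow_succ', mul_apply_eq_comp, ctmcJumpOp_apply]
    exact Finset.sum_nonneg fun e _ => mul_nonneg (hrate e) (ih _)

end Operator

/-- A bounded function as a bounded continuous function for the discrete topology. -/
theorem exists_boundedContinuous [TopologicalSpace S] [DiscreteTopology S] {f : S → ℝ} {C : ℝ}
    (hf : ∀ s, |f s| ≤ C) : ∃ g : BoundedContinuousFunction S ℝ, ⇑g = f :=
  ⟨.ofNormedAddCommGroup f continuous_of_discreteTopology C hf, rfl⟩

variable {rate : E → ℝ} {act : E → S → S} {f : S → ℝ} {C t : ℝ}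

theorem ctmcSemigroup_zero (f : S → ℝ) : ctmcSemigroup rate act 0 f = f := by
  ext s
  rw [ctmcSemigroup, tsum_eq_single 0 (fun k hk => by simp [hk])]
  simp

theorem ctmcSemigroup_nonneg (hrate : ∀ e, 0 ≤ rate e) (hf : ∀ s, |f s| ≤ C) (ht : 0 ≤ t)
    (hf0 : ∀ s, 0 ≤ f s) (s : S) : 0 ≤ ctmcSemigroup rate act t f s := by
  let _ : TopologicalSpace S := ⊥
  have : DiscreteTopology S := ⟨rfl⟩
  obtain ⟨g, rfl⟩ := exists_boundedContinuous hf
  rw [ctmcSemigroup_eq_exp, ctmcGenOp, expSemigroup_sub_smul_one]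
  exact mul_nonneg (Real.exp_nonneg _) (expSemigroup_ctmcJumpOp_nonneg hrate act ht hf0 s)

theorem ctmcSemigroup_sum {ι : Type*} (F : Finset ι) (c : ι → ℝ) (g : ι → S → ℝ) (D : ι → ℝ)
    (hg : ∀ i s, |g i s| ≤ D i) (s : S) :
    ctmcSemigroup rate act t (fun s => ∑ i ∈ F, c i * g i s) s =
      ∑ i ∈ F, c i * ctmcSemigroup rate act t (g i) s := by
  let _ : TopologicalSpace S := ⊥
  have : DiscreteTopology S := ⟨rfl⟩
  choose h hh using fun i => exists_boundedContinuous (hg i)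
  have hsum : (fun s => ∑ i ∈ F, c i * g i s) = ⇑(∑ i ∈ F, c i • h i) := by
    ext s
    simp [← hh]
  rw [hsum, ctmcSemigroup_eq_exp]
  simp [← hh, ctmcSemigroup_eq_exp]

theorem ctmcGenerator_const (c : ℝ) : ctmcGenerator rate act (fun _ : S => c) = 0 := by
  ext s
  simp [ctmcGenerator]

theorem ctmcSemigroup_const (c : ℝ) (s : S) : ctmcSemigroup rate act t (fun _ => c) s = c := by
  rw [ctmcSemigroup, tsum_eq_single 0]
  · simp
  · intro k hk
    obtain ⟨k, rfl⟩ := Nat.exists_eq_succ_of_ne_zero hk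
    have : ∀ k, (ctmcGenerator rate act)^[k] (0 : S → ℝ) = 0 := fun k =>
      Function.iterate_fixed (ctmcGenerator_const 0) k
    rw [Function.iterate_succ_apply, ctmcGenerator_const, this]
    simp

/-- Positivity applied to `C + f` and `C - f`, together with the conservation of constants, gives
the bound. -/
theorem abs_ctmcSemigroup_le (hrate : ∀ e, 0 ≤ rate e) (hf : ∀ s, |f s| ≤ C) (ht : 0 ≤ t)
    (s : S) : |ctmcSemigroup rate act t f s| ≤ C := by
  have key : ∀ c : ℝ, |c| = 1 → 0 ≤ C + c * ctmcSemigroup rate act t f s := by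
    intro c hc
    have hb : ∀ s, |C + c * f s| ≤ |C| + C := fun s =>
      (abs_add_le _ _).trans (by rw [abs_mul, hc, one_mul]; gcongr; exact hf s)
    have h0 : ∀ s, 0 ≤ C + c * f s := fun s => by
      have := neg_abs_le (c * f s)
      rw [abs_mul, hc, one_mul] at this
      linarith [hf s]
    have h := ctmcSemigroup_nonneg (act := act) hrate hb ht h0 s
    -- The two-term combination `C + c * f` is written as a sum over `Bool`, with the constant
    -- function as one of the terms.
    have hsum := ctmcSemigroup_sum (rate := rate) (act := act) (t := t) (Finset.univ : Finset Bool)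
      (fun b => if b then 1 else c) (fun b s => if b then C else f s)
      (fun b => if b then |C| else C) (fun b s => by cases b <;> simp [hf s]) s
    simp only [Fintype.sum_bool] at hsum
    simp [ctmcSemigroup_const] at hsum
    rwa [hsum] at h
  have h1 := key 1 (by simp)
  have h2 := key (-1) (by simp)
  rw [abs_le]
  constructor <;> linarith

theorem abs_ctmcGenerator_le (hrate : ∀ e, 0 ≤ rate e) (hf : ∀ s, |f s| ≤ C) (s : S) :
    |ctmcGenerator rate act f s| ≤ 2 * (∑ e, rate e) * C := by
  refine (Finset.abs_sum_le_sum_abs _ _).trans ?_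
  rw [Finset.mul_sum, Finset.sum_mul]
  gcongr with e
  rw [abs_mul, abs_of_nonneg (hrate e)]
  have := (abs_sub (f (act e s)) (f s)).trans (add_le_add (hf _) (hf _))
  nlinarith [hrate e]

theorem ctmcGenerator_ctmcSemigroup (hf : ∀ s, |f s| ≤ C) (s : S) :
    ctmcGenerator rate act (ctmcSemigroup rate act t f) s =
      ctmcSemigroup rate act t (ctmcGenerator rate act f) s := by
  let _ : TopologicalSpace S := ⊥
  have : DiscreteTopology S := ⟨rfl⟩
  obtain ⟨g, rfl⟩ := exists_boundedContinuous hf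
  have h1 : ctmcSemigroup rate act t ⇑g = ⇑(expSemigroup (ctmcGenOp rate act) t g) := by
    ext s
    rw [ctmcSemigroup_eq_exp]
  rw [h1, ← coe_ctmcGenOp, ← coe_ctmcGenOp, ctmcSemigroup_eq_exp]
  exact congr($(commute_expSemigroup (ctmcGenOp rate act) t g) s)

theorem hasDerivAt_ctmcSemigroup (hf : ∀ s, |f s| ≤ C) (s : S) (t : ℝ) :
    HasDerivAt (fun t => ctmcSemigroup rate act t f s)
      (ctmcGenerator rate act (ctmcSemigroup rate act t f) s) t := by
  let _ : TopologicalSpace S := ⊥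
  have : DiscreteTopology S := ⟨rfl⟩
  rw [ctmcGenerator_ctmcSemigroup hf]
  obtain ⟨g, rfl⟩ := exists_boundedContinuous hf
  rw [← coe_ctmcGenOp]
  simp only [ctmcSemigroup_eq_exp]
  exact hasDerivAt_expSemigroup (ctmcGenOp rate act) t g (BoundedContinuousFunction.evalCLM ℝ s)

theorem HasDerivAt.ctmcGenerator {u : ℝ → S → ℝ} {u' : S → ℝ}
    (h : ∀ s, HasDerivAt (fun t => u t s) (u' s) t) (s : S) :
    HasDerivAt (fun t => ctmcGenerator rate act (u t) s) (ctmcGenerator rate act u' s) t :=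
  HasDerivAt.fun_sum fun e _ => ((h (act e s)).sub (h s)).const_mul (rate e)

end Semigroup

/-! ### Limits of derivatives and of monotone functions. -/

/-- A convergent function with bounded second derivative has a derivative tending to zero. -/
theorem tendsto_deriv_zero_of_tendsto {φ φ' φ'' : ℝ → ℝ} {c K : ℝ}
    (hφ : Tendsto φ atTop (𝓝 c)) (h1 : ∀ t > 0, HasDerivAt φ (φ' t) t)
    (h2 : ∀ t > 0, HasDerivAt φ' (φ'' t) t) (hK : ∀ t > 0, |φ'' t| ≤ K) :
    Tendsto φ' atTop (𝓝 0) := by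
  have hK0 : 0 ≤ K := (abs_nonneg _).trans (hK 1 one_pos)
  -- The mean value theorem gives a point of `(t, t + h)` where `φ'` is the difference quotient;
  -- moving from there to `t` costs at most `K * h`.
  have key : ∀ t > 0, ∀ h > 0, |φ' t| ≤ |φ (t + h) - φ t| / h + K * h := by
    intro t ht h hh
    obtain ⟨ξ, hξ, hd⟩ := exists_hasDerivAt_eq_slope φ φ' (lt_add_of_pos_right t hh)
      (fun x hx => (h1 x (ht.trans_le hx.1)).continuousAt.continuousWithinAt)
      (fun x hx => h1 x (ht.trans hx.1))
    have hL : ‖φ' ξ - φ' t‖ ≤ K * ‖ξ - t‖ :=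
      (convex_Ioi (0 : ℝ)).norm_image_sub_le_of_norm_hasDerivWithin_le (f' := φ'')
        (fun x hx => (h2 x hx).hasDerivWithinAt) hK ht (ht.trans hξ.1)
    rw [Real.norm_eq_abs, Real.norm_eq_abs, abs_of_pos (sub_pos.2 hξ.1)] at hL
    have h3 : |φ' ξ| = |φ (t + h) - φ t| / h := by
      rw [hd, abs_div, add_sub_cancel_left, abs_of_pos hh]
    have h4 : |φ' t| ≤ |φ' ξ| + |φ' ξ - φ' t| := by
      have := abs_sub (φ' ξ) (φ' ξ - φ' t)
      rwa [sub_sub_cancel] at this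
    have h5 : K * (ξ - t) ≤ K * h := by
      gcongr
      linarith [hξ.2]
    linarith
  rw [Metric.tendsto_atTop]
  intro ε hε
  -- `K + 1` instead of `K` allows `K = 0` and makes `K * h < ε / 2` strict.
  set h : ℝ := ε / (2 * (K + 1)) with hh
  have hh0 : 0 < h := by positivity
  have hKh : K * h < ε / 2 := by
    rw [hh, ← mul_div_assoc, div_lt_div_iff₀ (by positivity) (by positivity)]
    nlinarith
  have ht : Tendsto (fun t => |φ (t + h) - φ t| / h) atTop (𝓝 0) := by
    have := (((hφ.comp (tendsto_atTop_add_const_right atTop h tendsto_id)).sub hφ).abs).div_const h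
    simpa using this
  obtain ⟨T, hT⟩ := eventually_atTop.1
    ((ht.eventually_lt_const (half_pos hε)).and (eventually_gt_atTop 0))
  refine ⟨T, fun t htT => ?_⟩
  rw [dist_zero_right, Real.norm_eq_abs]
  linarith [key t (hT t htT).2 h hh0, (hT t htT).1]

/-- A nonnegative function with nonpositive derivative converges. -/
theorem exists_tendsto_of_deriv_nonpos {φ φ' : ℝ → ℝ} (h0 : ∀ t > 0, 0 ≤ φ t)
    (h1 : ∀ t > 0, HasDerivAt φ (φ' t) t) (h' : ∀ t > 0, φ' t ≤ 0) :
    ∃ c, Tendsto φ atTop (𝓝 c) := by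
  have hanti : AntitoneOn φ (Set.Ioi 0) :=
    antitoneOn_of_deriv_nonpos (convex_Ioi 0)
      (fun t ht => (h1 t ht).continuousAt.continuousWithinAt)
      (fun t ht => (h1 t (interior_subset ht)).differentiableAt.differentiableWithinAt)
      (fun t ht => by
        rw [(h1 t (interior_subset ht)).deriv]
        exact h' t (interior_subset ht))
  have hmax : ∀ t : ℝ, 0 < max t 1 := fun t => lt_max_of_lt_right one_pos
  have hanti' : Antitone fun t => φ (max t 1) := fun a b hab =>
    hanti (hmax a) (hmax b) (max_le_max_right 1 hab)
  refine ⟨_, (tendsto_atTop_ciInf hanti' ⟨0, ?_⟩).congr' ?_⟩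
  · rintro _ ⟨t, rfl⟩
    exact h0 _ (hmax t)
  · filter_upwards [eventually_ge_atTop 1] with t ht
    rw [max_eq_left ht]

/-! ### Sums against a weight, for functions dominated by a possibly unbounded `b`. -/

section WeightedSums

variable {S : Type*} {w b f : S → ℝ} {C D : ℝ}

theorem abs_weight_mul_le (hw0 : ∀ s, 0 ≤ w s) (hf : ∀ s, |f s| ≤ C * b s) (s : S) :
    ‖w s * f s‖ ≤ w s * b s * C := by
  rw [norm_mul, Real.norm_of_nonneg (hw0 s), mul_assoc, mul_comm (b s)]
  exact mul_le_mul_of_nonneg_left (hf s) (hw0 s)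

theorem summable_weight_mul (hw : Summable fun s => w s * b s) (hw0 : ∀ s, 0 ≤ w s)
    (hf : ∀ s, |f s| ≤ C * b s) : Summable fun s => w s * f s :=
  .of_norm_bounded (hw.mul_right C) (abs_weight_mul_le hw0 hf)

theorem abs_tsum_weight_mul_le (hw : Summable fun s => w s * b s) (hw0 : ∀ s, 0 ≤ w s)
    (hf : ∀ s, |f s| ≤ C * b s) : |∑' s, w s * f s| ≤ (∑' s, w s * b s) * C := by
  rw [← tsum_mul_right, ← Real.norm_eq_abs]
  exact tsum_of_norm_bounded (hw.mul_right C).hasSum (abs_weight_mul_le hw0 hf)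

theorem hasDerivAt_tsum_weight_mul {g g' : ℝ → S → ℝ} {t : ℝ}
    (hw : Summable fun s => w s * b s) (hw0 : ∀ s, 0 ≤ w s) (hg : ∀ t > 0, ∀ s, |g t s| ≤ D * b s)
    (hd : ∀ t > 0, ∀ s, HasDerivAt (fun t => g t s) (g' t s) t)
    (hg' : ∀ t > 0, ∀ s, |g' t s| ≤ C * b s) (ht : 0 < t) :
    HasDerivAt (fun t => ∑' s, w s * g t s) (∑' s, w s * g' t s) t :=
  hasDerivAt_tsum_of_isPreconnected (g := fun s t => w s * g t s) (g' := fun s t => w s * g' t s)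
    (hw.mul_right C) isOpen_Ioi isPreconnected_Ioi
    (fun s t ht => (hd t ht s).const_mul (w s))
    (fun s t ht => abs_weight_mul_le hw0 (hg' t ht) s)
    (Set.mem_Ioi.2 ht) (summable_weight_mul hw hw0 (hg t ht)) ht

end WeightedSums

/-! ### Stationary distributions and long-time behaviour. -/

section Ergodicity

variable {S E : Type*} [Fintype E] {rate : E → ℝ} {act : E → S → S} {f w : S → ℝ} {C : ℝ}

theorem hasDerivAt_ctmcGenerator_ctmcSemigroup (hf : ∀ s, |f s| ≤ C) (s : S) (t : ℝ) :
    HasDerivAt (fun t => ctmcGenerator rate act (ctmcSemigroup rate act t f) s)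
      (ctmcGenerator rate act (ctmcGenerator rate act (ctmcSemigroup rate act t f)) s) t :=
  HasDerivAt.ctmcGenerator (fun s => hasDerivAt_ctmcSemigroup hf s t) s

/-- If the expectation of `f` converges from an initial state, then so does that of its
generator, to zero. -/
theorem tendsto_ctmcGenerator_ctmcSemigroup (hrate : ∀ e, 0 ≤ rate e) (hf : ∀ s, |f s| ≤ C)
    {s : S} {c : ℝ} (h : Tendsto (fun t => ctmcSemigroup rate act t f s) atTop (𝓝 c)) :
    Tendsto (fun t => ctmcGenerator rate act (ctmcSemigroup rate act t f) s) atTop (𝓝 0) :=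
  tendsto_deriv_zero_of_tendsto h (fun t _ => hasDerivAt_ctmcSemigroup hf s t)
    (fun t _ => hasDerivAt_ctmcGenerator_ctmcSemigroup hf s t)
    (fun _ ht => abs_ctmcGenerator_le hrate
      (abs_ctmcGenerator_le hrate (abs_ctmcSemigroup_le hrate hf (le_of_lt ht))) s)

/-- The last sum is the carré du champ. Since `G (f ^ 2)` has stationary mean zero, its mean is the
dissipation rate of the second moment. -/
theorem ctmcGenerator_sq (f : S → ℝ) (s : S) :
    ctmcGenerator rate act (fun s => f s ^ 2) s =
      2 * (f s * ctmcGenerator rate act f s) + ∑ e, rate e * (f (act e s) - f s) ^ 2 := by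
  simp only [ctmcGenerator, Finset.mul_sum, ← Finset.sum_add_distrib]
  exact Finset.sum_congr rfl fun e _ => by ring

/-- Dissipation of the variance: under a stationary distribution `w`, the expectation of a bounded
function forgets every jump that is possible. -/
theorem tendsto_ctmcSemigroup_act_sub (hrate : ∀ e, 0 ≤ rate e) (hw : Summable w)
    (hw0 : ∀ s, 0 ≤ w s)
    (hstat : ∀ (g : S → ℝ) (D : ℝ), (∀ s, |g s| ≤ D) → ∑' s, w s * ctmcGenerator rate act g s = 0)
    (hf : ∀ s, |f s| ≤ C) {s : S} (hs : 0 < w s) {e : E} (he : 0 < rate e) :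
    Tendsto (fun t => ctmcSemigroup rate act t f (act e s) - ctmcSemigroup rate act t f s)
      atTop (𝓝 0) := by
  set u := fun t => ctmcSemigroup rate act t f
  set G := ctmcGenerator rate act
  set Λ := ∑ e, rate e
  have hw1 : Summable fun s => w s * 1 := by simpa using hw
  have hu : ∀ t > 0, ∀ s, |u t s| ≤ C := fun t ht => abs_ctmcSemigroup_le hrate hf (le_of_lt ht)
  have hGu : ∀ t > 0, ∀ s, |G (u t) s| ≤ 2 * Λ * C := fun t ht => abs_ctmcGenerator_le hrate (hu t ht)
  have hGGu : ∀ t > 0, ∀ s, |G (G (u t)) s| ≤ 2 * Λ * (2 * Λ * C) := fun t ht =>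
    abs_ctmcGenerator_le hrate (hGu t ht)
  have hC : 0 ≤ C := (abs_nonneg _).trans (hf s)
  have hΛ : 0 ≤ Λ := Finset.sum_nonneg fun e _ => hrate e
  have hmul : ∀ {a b A B : ℝ}, |a| ≤ A → |b| ≤ B → 0 ≤ A → |a * b| ≤ A * B := by
    intro a b A B ha hb hA
    rw [abs_mul]
    exact mul_le_mul ha hb (abs_nonneg _) hA
  have hsq : ∀ t > 0, ∀ s, |u t s ^ 2| ≤ C * C * 1 := fun t ht s => by
    rw [mul_one, sq]
    exact hmul (hu t ht s) (hu t ht s) hC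
  have hb1 : ∀ t > 0, ∀ s, |2 * (u t s * G (u t) s)| ≤ 2 * (C * (2 * Λ * C)) * 1 := fun t ht s => by
    rw [mul_one]
    exact hmul (by simp) (hmul (hu t ht s) (hGu t ht s) hC) zero_le_two
  have hb2 : ∀ t > 0, ∀ s, |2 * (G (u t) s * G (u t) s + u t s * G (G (u t)) s)| ≤
      2 * (2 * Λ * C * (2 * Λ * C) + C * (2 * Λ * (2 * Λ * C))) * 1 := fun t ht s => by
    rw [mul_one]
    exact hmul (by simp) ((abs_add_le _ _).trans (add_le_add
      (hmul (hGu t ht s) (hGu t ht s) (by positivity)) (hmul (hu t ht s) (hGGu t ht s) hC)))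
      zero_le_two
  have hd : ∀ t > 0, HasDerivAt (fun t => ∑' s, w s * u t s ^ 2)
      (∑' s, w s * (2 * (u t s * G (u t) s))) t := fun t ht =>
    hasDerivAt_tsum_weight_mul hw1 hw0 hsq (fun t _ s => by
      refine ((hasDerivAt_ctmcSemigroup hf s t).pow 2).congr_deriv ?_
      simp only [u, G]
      ring) hb1 ht
  have hdd : ∀ t > 0, HasDerivAt (fun t => ∑' s, w s * (2 * (u t s * G (u t) s)))
      (∑' s, w s * (2 * (G (u t) s * G (u t) s + u t s * G (G (u t)) s))) t := fun t ht =>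
    hasDerivAt_tsum_weight_mul hw1 hw0 hb1 (fun t _ s =>
      ((hasDerivAt_ctmcSemigroup hf s t).mul
        (hasDerivAt_ctmcGenerator_ctmcSemigroup hf s t)).const_mul 2) hb2 ht
  -- Stationarity tested on `u t ^ 2` identifies the mean squared jump with minus the derivative of
  -- the second moment.
  have hdis : ∀ t > 0, HasSum (fun s => w s * ∑ e, rate e * (u t (act e s) - u t s) ^ 2)
      (-∑' s, w s * (2 * (u t s * G (u t) s))) := by
    intro t ht
    have hsq' := abs_ctmcGenerator_le (act := act) hrate (hsq t ht)
    have h1 : HasSum (fun s => w s * G (fun s => u t s ^ 2) s) 0 := by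
      rw [← hstat _ _ (hsq t ht)]
      exact (summable_weight_mul hw1 hw0 fun s => (hsq' s).trans_eq (mul_one _).symm).hasSum
    have h2 := h1.sub (summable_weight_mul hw1 hw0 (hb1 t ht)).hasSum
    rw [zero_sub] at h2
    refine h2.congr_fun fun s => ?_
    simp only [G, ctmcGenerator_sq]
    ring
  have hdis0 : ∀ t s, 0 ≤ ∑ e, rate e * (u t (act e s) - u t s) ^ 2 := fun t s =>
    Finset.sum_nonneg fun e _ => mul_nonneg (hrate e) (sq_nonneg _)
  -- The second moment decreases and is nonnegative, so it converges and its derivative vanishes in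
  -- the limit. All terms of the dissipation being nonnegative, each one vanishes.
  obtain ⟨c, hc⟩ := exists_tendsto_of_deriv_nonpos
    (fun t _ => tsum_nonneg fun s => mul_nonneg (hw0 s) (sq_nonneg (u t s))) hd
    (fun t ht => neg_nonneg.1 ((hdis t ht).nonneg fun s => mul_nonneg (hw0 s) (hdis0 t s)))
  have h0 := (tendsto_deriv_zero_of_tendsto hc hd hdd
    (fun t ht => abs_tsum_weight_mul_le hw1 hw0 (hb2 t ht))).neg
  rw [neg_zero] at h0
  have hk : 0 < w s * rate e := mul_pos hs he
  have h1 := h0.div_const (w s * rate e)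
  rw [zero_div] at h1
  have h2 : Tendsto (fun t => (u t (act e s) - u t s) ^ 2) atTop (𝓝 0) := by
    refine squeeze_zero' (.of_forall fun t => sq_nonneg _) ?_ h1
    filter_upwards [eventually_gt_atTop 0] with t ht
    rw [le_div_iff₀ hk, mul_comm, mul_assoc]
    calc w s * (rate e * (u t (act e s) - u t s) ^ 2)
        ≤ w s * ∑ e, rate e * (u t (act e s) - u t s) ^ 2 :=
          mul_le_mul_of_nonneg_left (Finset.single_le_sum
            (f := fun e => rate e * (u t (act e s) - u t s) ^ 2)
            (fun e _ => mul_nonneg (hrate e) (sq_nonneg _)) (Finset.mem_univ e)) (hw0 s)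
      _ ≤ _ := le_hasSum (hdis t ht) s fun s' _ => mul_nonneg (hw0 s') (hdis0 t s')
  have h3 := h2.sqrt
  simp only [Real.sqrt_sq_eq_abs, Real.sqrt_zero] at h3
  exact tendsto_zero_iff_abs_tendsto_zero _ |>.2 h3

/-- Expectations under a stationary distribution do not change in time. -/
theorem tsum_weight_mul_ctmcSemigroup (hrate : ∀ e, 0 ≤ rate e) (hw : Summable w)
    (hw0 : ∀ s, 0 ≤ w s)
    (hstat : ∀ (g : S → ℝ) (D : ℝ), (∀ s, |g s| ≤ D) → ∑' s, w s * ctmcGenerator rate act g s = 0)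
    (hf : ∀ s, |f s| ≤ C) {t : ℝ} (ht : 0 ≤ t) :
    ∑' s, w s * ctmcSemigroup rate act t f s = ∑' s, w s * f s := by
  have hw1 : Summable fun s => w s * 1 := by simpa using hw
  have hu : ∀ t ≥ 0, ∀ s, |ctmcSemigroup rate act t f s| ≤ C * 1 := fun t ht s =>
    (abs_ctmcSemigroup_le hrate hf ht s).trans_eq (mul_one C).symm
  have hd : ∀ t > 0, HasDerivAt (fun t => ∑' s, w s * ctmcSemigroup rate act t f s) 0 t := by
    intro t ht
    rw [← hstat _ _ (hu t (le_of_lt ht))]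
    exact hasDerivAt_tsum_weight_mul hw1 hw0 (fun t ht => hu t (le_of_lt ht))
      (fun t _ s => hasDerivAt_ctmcSemigroup hf s t)
      (fun t ht s => (abs_ctmcGenerator_le hrate (hu t (le_of_lt ht)) s).trans_eq
        (mul_one _).symm) ht
  -- The derivative is available only for positive times; continuity extends the conservation to
  -- time zero.
  have hcont : ContinuousOn (fun t => ∑' s, w s * ctmcSemigroup rate act t f s) (Set.Ici 0) :=
    continuousOn_tsum (fun s => (continuous_const.mul (continuous_iff_continuousAt.2 fun t =>
      (hasDerivAt_ctmcSemigroup hf s t).continuousAt)).continuousOn) (hw1.mul_right C)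
      (fun s t ht => abs_weight_mul_le hw0 (hu t ht) s)
  rcases ht.eq_or_lt with rfl | ht
  · rw [ctmcSemigroup_zero]
  · obtain ⟨ξ, -, h⟩ := exists_hasDerivAt_eq_slope _ _ ht (hcont.mono Set.Icc_subset_Ici_self)
      fun x hx => hd x hx.1
    rw [eq_comm, div_eq_zero_iff, or_iff_left (by linarith), sub_eq_zero,
      ctmcSemigroup_zero] at h
    exact h

/-- If a nonnegative function has vanishing expectation in the long run when started from `s`,
then also when started from a state that can be reached from `s`. -/
theorem tendsto_ctmcSemigroup_act_zero (hrate : ∀ e, 0 ≤ rate e) (hf : ∀ s, |f s| ≤ C)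
    (hf0 : ∀ s, 0 ≤ f s) {s : S} {e : E} (he : 0 < rate e)
    (h : Tendsto (fun t => ctmcSemigroup rate act t f s) atTop (𝓝 0)) :
    Tendsto (fun t => ctmcSemigroup rate act t f (act e s)) atTop (𝓝 0) := by
  -- Adding the total rate times `u s` to `G u s` leaves `∑ₑ rate e * u (act e s)`, whose terms are
  -- all nonnegative.
  have h1 := ((tendsto_ctmcGenerator_ctmcSemigroup hrate hf h).add
    (h.const_mul (∑ e, rate e))).div_const (rate e)
  rw [mul_zero, add_zero, zero_div] at h1
  refine squeeze_zero' ?_ ?_ h1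
  · filter_upwards [eventually_ge_atTop 0] with t ht
    exact ctmcSemigroup_nonneg hrate hf ht hf0 _
  · filter_upwards [eventually_ge_atTop 0] with t ht
    rw [le_div_iff₀ he, ctmcGenerator, Finset.sum_mul, ← Finset.sum_add_distrib, mul_comm]
    have h2 := Finset.single_le_sum (f := fun e => rate e * ctmcSemigroup rate act t f (act e s))
      (fun e _ => mul_nonneg (hrate e) (ctmcSemigroup_nonneg hrate hf ht hf0 _))
      (Finset.mem_univ e)
    refine h2.trans_eq (Finset.sum_congr rfl fun e _ => ?_)
    ring

end Ergodicity

/-! ### Global balance for product-form weights. -/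

theorem JacksonNetwork.eventRate_nonneg {V : Type*} [Fintype V] (N : JacksonNetwork V) (e : NetEvent V) :
    0 ≤ N.eventRate e := by
  rcases e with x | ⟨y, _ | x⟩
  · exact N.input_nonneg x
  · exact mul_nonneg (N.service_pos y).le (N.leave_nonneg y)
  · exact mul_nonneg (N.service_pos y).le (N.route_nonneg y x)

theorem JacksonNetwork.ctmcGenerator_eventRate {V S : Type*} [Fintype V] (N : JacksonNetwork V)
    (act : NetEvent V → S → S) (F : S → ℝ) (s : S) :
    ctmcGenerator N.eventRate act F s =
      ∑ x, N.input x * (F (act (Sum.inl x) s) - F s) +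
      ∑ y, (N.service y * N.leave y * (F (act (Sum.inr (y, none)) s) - F s) +
        ∑ x, N.service y * N.route y x * (F (act (Sum.inr (y, some x)) s) - F s)) := by
  simp [ctmcGenerator, Fintype.sum_sum_type, Fintype.sum_prod_type, Fintype.sum_option,
    JacksonNetwork.eventRate]

section JacksonBalance

variable {V : Type*} [DecidableEq V]

@[simp] theorem addPacket_same (n : V → ℕ) (x : V) : addPacket n x x = n x + 1 := by
  simp [addPacket]

theorem addPacket_of_ne (n : V → ℕ) {x y : V} (h : y ≠ x) : addPacket n x y = n y := by
  simp [addPacket, h]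

@[simp] theorem removePacket_addPacket (n : V → ℕ) (x : V) :
    removePacket (addPacket n x) x = n := by
  simp [removePacket, addPacket]

theorem addPacket_removePacket {n : V → ℕ} {x : V} (h : n x ≠ 0) :
    addPacket (removePacket n x) x = n := by
  simp [removePacket, addPacket, Nat.sub_add_cancel (Nat.one_le_iff_ne_zero.2 h)]

theorem addPacket_injective (x : V) : Function.Injective fun n : V → ℕ => addPacket n x :=
  Function.LeftInverse.injective (g := fun n => removePacket n x) fun n =>
    removePacket_addPacket n x

theorem apply_eq_zero_of_notMem_range_addPacket {n : V → ℕ} {x : V}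
    (h : n ∉ Set.range fun n : V → ℕ => addPacket n x) : n x = 0 := by
  by_contra hn
  exact h ⟨_, addPacket_removePacket hn⟩

theorem sum_addPacket [Fintype V] (n : V → ℕ) (x : V) : ∑ i, addPacket n x i = ∑ i, n i + 1 := by
  rw [addPacket, Finset.sum_update_of_mem (Finset.mem_univ x),
    ← Finset.add_sum_erase _ n (Finset.mem_univ x), Finset.sdiff_singleton_eq_erase]
  ring

theorem sum_removePacket [Fintype V] {n : V → ℕ} {x : V} (h : n x ≠ 0) :
    ∑ i, removePacket n x i + 1 = ∑ i, n i := by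
  rw [← sum_addPacket, addPacket_removePacket h]

/-- States with a nonempty queue at `y` are exactly those of the form `addPacket n y`; reindexing by
`n` costs the factor `ρ`. -/
theorem hasSum_nonempty_queue {w : (V → ℕ) → ℝ} {ρ : ℝ} {y : V}
    (hw : ∀ n, w (addPacket n y) = ρ * w n) {g : (V → ℕ) → ℝ} {a : ℝ}
    (hg : HasSum (fun n => w n * g (addPacket n y)) a) :
    HasSum (fun n => if n y = 0 then 0 else w n * g n) (ρ * a) := by
  refine ((addPacket_injective y).hasSum_iff fun n hn => ?_).1 ?_
  · rw [if_pos (apply_eq_zero_of_notMem_range_addPacket hn)]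
  · refine (hg.mul_left ρ).congr_fun fun n => ?_
    simp [hw, mul_assoc]

/-- Global balance of a product-form distribution, tested against any function that is
integrable. -/
theorem JacksonNetwork.hasSum_weight_mul_ctmcGenerator [Fintype V] (N : JacksonNetwork V) {ρ : V → ℝ}
    (hρ : ∀ x, 0 < ρ x) (hs : N.IsSiteTraffic fun x => N.service x * ρ x) {w : (V → ℕ) → ℝ}
    (hw : ∀ n x, w (addPacket n x) = ρ x * w n) {F : (V → ℕ) → ℝ}
    (hF : Summable fun n => w n * F n) :
    HasSum (fun n => w n * ctmcGenerator N.eventRate queueAct F n) 0 := by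
  obtain ⟨b, hb⟩ := hF
  have hadd : ∀ x, Summable fun n => w n * F (addPacket n x) := by
    intro x
    refine (((hb.summable.comp_injective (addPacket_injective x)).mul_left (ρ x)⁻¹)).congr fun n => ?_
    have := (hρ x).ne'
    simp only [Function.comp_apply, hw]
    field_simp
  choose a ha using hadd
  have harr : ∀ x, HasSum (fun n => w n * (N.input x * (F (queueAct (Sum.inl x) n) - F n)))
      (N.input x * (a x - b)) := by
    intro x
    refine (((ha x).sub hb).mul_left (N.input x)).congr_fun fun n => ?_
    simp only [queueAct]
    ring
  have hdep : ∀ y, HasSum (fun n => w n * (N.service y * N.leave y *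
      (F (queueAct (Sum.inr (y, none)) n) - F n)))
      (N.service y * N.leave y * (ρ y * (b - a y))) := by
    intro y
    have h := hasSum_nonempty_queue (fun n => hw n y)
      (g := fun n => F (removePacket n y) - F n) (a := b - a y)
      ((hb.sub (ha y)).congr_fun fun n => by rw [removePacket_addPacket]; ring)
    refine (h.mul_left (N.service y * N.leave y)).congr_fun fun n => ?_
    simp only [queueAct]
    split_ifs <;> ring
  have hfwd : ∀ y x, HasSum (fun n => w n * (N.service y * N.route y x *
      (F (queueAct (Sum.inr (y, some x)) n) - F n)))
      (N.service y * N.route y x * (ρ y * (a x - a y))) := by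
    intro y x
    have h := hasSum_nonempty_queue (fun n => hw n y)
      (g := fun n => F (addPacket (removePacket n y) x) - F n) (a := a x - a y)
      (((ha x).sub (ha y)).congr_fun fun n => by rw [removePacket_addPacket]; ring)
    refine (h.mul_left (N.service y * N.route y x)).congr_fun fun n => ?_
    simp only [queueAct]
    split_ifs <;> ring
  have h := (hasSum_sum fun x (_ : x ∈ Finset.univ) => harr x).add
    (hasSum_sum fun y (_ : y ∈ Finset.univ) =>
      (hdep y).add (hasSum_sum fun x (_ : x ∈ Finset.univ) => hfwd y x))
  have hval : ∑ x, N.input x * (a x - b) + ∑ y, (N.service y * N.leave y * (ρ y * (b - a y)) +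
      ∑ x, N.service y * N.route y x * (ρ y * (a x - a y))) = 0 := by
    -- The traffic equations express the input as the throughput minus the routed flow; the rest
    -- follows from the row sums of the routing.
    have hin : ∑ x, N.input x * (a x - b) = ∑ y, (N.service y * ρ y * (a y - b) -
        ∑ x, N.service y * ρ y * N.route y x * (a x - b)) := by
      rw [Finset.sum_sub_distrib, Finset.sum_comm, ← Finset.sum_sub_distrib]
      refine Finset.sum_congr rfl fun x _ => ?_
      rw [← Finset.sum_mul, ← sub_mul]
      congr 1
      linarith [hs x]
    rw [hin, ← Finset.sum_add_distrib]
    refine Finset.sum_eq_zero fun y _ => ?_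
    have hdiff : ∑ x, N.service y * N.route y x * (ρ y * (a x - a y)) -
        ∑ x, N.service y * ρ y * N.route y x * (a x - b) =
        (∑ x, N.route y x) * (N.service y * ρ y * (b - a y)) := by
      rw [← Finset.sum_sub_distrib, Finset.sum_mul]
      exact Finset.sum_congr rfl fun x _ => by ring
    rw [N.sum_route] at hdiff
    linarith
  rw [hval] at h
  refine h.congr_fun fun n => ?_
  rw [N.ctmcGenerator_eventRate, mul_add, Finset.mul_sum, Finset.mul_sum]
  simp only [mul_add, Finset.mul_sum]

end JacksonBalance

theorem PMF.hasSum_toReal {α : Type*} (P : PMF α) : HasSum (fun a => (P a).toReal) 1 := by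
  have h := (ENNReal.summable_toReal P.tsum_coe_ne_top).hasSum
  rwa [← ENNReal.tsum_toReal_eq P.apply_ne_top, P.tsum_coe, ENNReal.toReal_one] at h

/-! ### Stable states: sufficiency of the product form, necessity of spare capacity. -/

section StableState

variable {V : Type*} [DecidableEq V] [Fintype V]

theorem packet_induction {p : (V → ℕ) → Prop} (h0 : p 0)
    (hadd : ∀ n x, p n → p (addPacket n x)) (n : V → ℕ) : p n := by
  induction hk : ∑ i, n i generalizing n with
  | zero =>
    have : n = 0 := funext fun i => (Finset.sum_eq_zero_iff.1 hk) i (Finset.mem_univ i)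
    rwa [this]
  | succ k ih =>
    obtain ⟨x, -, hx⟩ := Finset.exists_ne_zero_of_sum_ne_zero (hk.trans_ne k.succ_ne_zero)
    rw [← addPacket_removePacket hx]
    exact hadd _ _ (ih _ (by have := sum_removePacket hx; omega))

theorem abs_indicator_one_le {S : Type*} (A : Set S) (s : S) :
    |A.indicator (1 : S → ℝ) s| ≤ 1 := by
  by_cases h : s ∈ A <;> simp [h]

theorem tsum_weight_mul_indicator {S : Type*} (w : S → ℝ) (m : S) :
    ∑' n, w n * Set.indicator {m} (1 : S → ℝ) n = w m := by
  rw [tsum_eq_single m]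
  · simp
  · intro n hn
    simp [hn]

/-- A product-form distribution with the loads of the traffic equations is the stable state. -/
theorem JacksonNetwork.isStableState_of_productForm (N : JacksonNetwork V)
    (hin : ∀ x, 0 < N.input x) {ρ : V → ℝ} (hρ : ∀ x, 0 < ρ x)
    (hs : N.IsSiteTraffic fun x => N.service x * ρ x) {P : PMF (V → ℕ)} (hP : ∀ n, P n ≠ 0)
    (hw : ∀ n x, (P (addPacket n x)).toReal = ρ x * (P n).toReal) : N.IsStableState P := by
  intro n m
  set w := fun n => (P n).toReal
  have hw1 : HasSum w 1 := P.hasSum_toReal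
  have hw0 : ∀ n, 0 ≤ w n := fun n => ENNReal.toReal_nonneg
  have hwpos : ∀ n, 0 < w n := fun n => ENNReal.toReal_pos (hP n) (P.apply_ne_top n)
  have hwb : Summable fun n => w n * 1 := by simpa using hw1.summable
  have hstat : ∀ (g : (V → ℕ) → ℝ) (D : ℝ), (∀ n, |g n| ≤ D) →
      ∑' n, w n * ctmcGenerator N.eventRate queueAct g n = 0 := fun g D hg =>
    (N.hasSum_weight_mul_ctmcGenerator hρ hs hw
      (summable_weight_mul hwb hw0 fun n => (hg n).trans_eq (mul_one D).symm)).tsum_eq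
  have hf := abs_indicator_one_le ({m} : Set (V → ℕ))
  set u := fun t n => ctmcSemigroup N.eventRate queueAct t (Set.indicator {m} 1) n
  have hjump : ∀ n x, Tendsto (fun t => u t (addPacket n x) - u t n) atTop (𝓝 0) := fun n x =>
    tendsto_ctmcSemigroup_act_sub N.eventRate_nonneg hw1.summable hw0 hstat hf (hwpos n)
      (e := Sum.inl x) (hin x)
  -- Each state is reached from the empty one by arrivals, and `u` asymptotically forgets every
  -- arrival.
  have hzero : ∀ n', Tendsto (fun t => u t n' - u t 0) atTop (𝓝 0) := by
    refine packet_induction (by simp) fun n x hn => ?_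
    simpa using (hjump n x).add hn
  have hdiff : ∀ n', Tendsto (fun t => w n' * (u t n' - u t n)) atTop (𝓝 0) := fun n' => by
    simpa using ((hzero n').sub (hzero n)).const_mul (w n')
  have hub : ∀ t ≥ 0, ∀ n, |u t n| ≤ 1 := fun t ht => abs_ctmcSemigroup_le N.eventRate_nonneg hf ht
  have hlim := tendsto_tsum_of_dominated_convergence (hwb.mul_right 2) hdiff (by
    filter_upwards [eventually_ge_atTop 0] with t ht n'
    refine abs_weight_mul_le (b := fun _ => 1) (f := fun n' => u t n' - u t n) hw0 (fun n' => ?_) n'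
    have := (abs_sub (u t n') (u t n)).trans (add_le_add (hub t ht n') (hub t ht n))
    linarith)
  rw [tsum_zero] at hlim
  have hlim' := (tendsto_const_nhds (x := w m)).sub hlim
  rw [sub_zero] at hlim'
  refine hlim'.congr' ?_
  filter_upwards [eventually_ge_atTop 0] with t ht
  have h1 : HasSum (fun n' => w n' * u t n') (w m) := by
    rw [← tsum_weight_mul_indicator w m,
      ← tsum_weight_mul_ctmcSemigroup N.eventRate_nonneg hw1.summable hw0 hstat hf ht]
    exact (summable_weight_mul hwb hw0 fun n => (hub t ht n).trans_eq (mul_one 1).symm).hasSum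
  have h2 : HasSum (fun n' => w n' * (u t n' - u t n)) (w m - 1 * u t n) :=
    (h1.sub (hw1.mul_right (u t n))).congr_fun fun n' => by ring
  rw [h2.tsum_eq]
  simp [u, JacksonNetwork.transitionProb]

theorem sum_queueAct_le (e : NetEvent V) (n : V → ℕ) :
    ∑ i, queueAct e n i ≤ ∑ i, n i + 1 ∧ ∑ i, n i ≤ ∑ i, queueAct e n i + 1 := by
  rcases e with x | ⟨y, o⟩
  · simp only [queueAct, sum_addPacket]
    omega
  · by_cases h : n y = 0
    · cases o <;> simp [queueAct, h]
    · have := sum_removePacket h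
      cases o <;> simp only [queueAct, if_neg h, sum_addPacket] <;> omega

/-- A stable state satisfies global balance, tested against functions of finite support. -/
theorem JacksonNetwork.IsStableState.tsum_ctmcGenerator {N : JacksonNetwork V}
    {P : PMF (V → ℕ)} (hP : N.IsStableState P) {f : (V → ℕ) → ℝ} {K : ℕ}
    (hf : ∀ n, K < ∑ i, n i → f n = 0) :
    ∑' n, (P n).toReal * ctmcGenerator N.eventRate queueAct f n = 0 := by
  have hbox : ∀ {g : (V → ℕ) → ℝ} {k : ℕ}, (∀ n, k < ∑ i, n i → g n = 0) →
      ∀ n, n ∉ Fintype.piFinset (fun _ : V => Finset.range (k + 1)) → g n = 0 := by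
    intro g k hg n hn
    simp only [Fintype.mem_piFinset, Finset.mem_range, not_forall, not_lt] at hn
    obtain ⟨i, hi⟩ := hn
    exact hg n (hi.trans (Finset.single_le_sum (f := n) (fun _ _ => Nat.zero_le _)
      (Finset.mem_univ i)))
  have hlim : ∀ {g : (V → ℕ) → ℝ} {k : ℕ}, (∀ n, k < ∑ i, n i → g n = 0) → ∀ n,
      Tendsto (fun t => ctmcSemigroup N.eventRate queueAct t g n) atTop
        (𝓝 (∑' m, (P m).toReal * g m)) := by
    intro g k hg n
    -- Stability controls single transition probabilities only; a finitely supported function is a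
    -- finite combination of indicators.
    have hgsum : g = fun n => ∑ m ∈ Fintype.piFinset (fun _ : V => Finset.range (k + 1)),
        g m * Set.indicator {m} (1 : (V → ℕ) → ℝ) n := by
      ext n
      simp only [Set.indicator_apply, Set.mem_singleton_iff, Pi.one_apply, mul_ite, mul_one,
        mul_zero, Finset.sum_ite_eq]
      split_ifs with h
      · rfl
      · exact hbox hg n h
    rw [tsum_eq_sum fun m hm => by rw [hbox hg m hm, mul_zero]]
    conv in (fun t => _) =>
      intro t
      rw [hgsum, ctmcSemigroup_sum _ _ _ (fun _ => 1) fun m => abs_indicator_one_le {m}]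
    simp only [mul_comm (P _).toReal]
    exact tendsto_finsetSum _ fun m _ => (hP n m).const_mul (g m)
  obtain ⟨C, hC⟩ : ∃ C, ∀ n, |f n| ≤ C := by
    refine ⟨∑ m ∈ Fintype.piFinset (fun _ : V => Finset.range (K + 1)), |f m|, fun n => ?_⟩
    by_cases hn : n ∈ Fintype.piFinset (fun _ : V => Finset.range (K + 1))
    · exact Finset.single_le_sum (f := fun m => |f m|) (fun _ _ => abs_nonneg _) hn
    · rw [hbox hf n hn, abs_zero]
      exact Finset.sum_nonneg fun _ _ => abs_nonneg _
  have hG : ∀ n, K + 1 < ∑ i, n i → ctmcGenerator N.eventRate queueAct f n = 0 := fun n hn =>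
    Finset.sum_eq_zero fun e _ => by
      rw [hf n (by omega), hf _ (by have := (sum_queueAct_le e n).2; omega)]
      simp
  -- The derivative of the expectation of `f` tends to zero. It is also the expectation of `G f`,
  -- which again has finite support and so converges to its mean under `P`.
  have h := tendsto_ctmcGenerator_ctmcSemigroup N.eventRate_nonneg hC (hlim hf 0)
  simp only [ctmcGenerator_ctmcSemigroup hC] at h
  exact tendsto_nhds_unique (hlim hG 0) h

/-- Otherwise null probability spreads upwards: if `m` has probability zero, balance at `m` forbids
any inflow into `m`, in particular a departure from `addPacket m y`. Then all states would be null.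
-/
theorem JacksonNetwork.IsStableState.toReal_zero_pos {N : JacksonNetwork V}
    {P : PMF (V → ℕ)} (hP : N.IsStableState P) (hleave : ∀ y, 0 < N.leave y) :
    0 < (P 0).toReal := by
  refine ENNReal.toReal_nonneg.lt_of_ne' fun h0 => ?_
  have hall : ∀ n, (P n).toReal = 0 := by
    refine packet_induction h0 fun m y hm => ?_
    set f := Set.indicator {m} (1 : (V → ℕ) → ℝ)
    have hf0 : ∀ n, 0 ≤ f n := fun n => Set.indicator_nonneg (fun _ _ => zero_le_one) n
    have hstat := hP.tsum_ctmcGenerator (f := f) (K := ∑ i, m i) fun n hn => by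
      refine Set.indicator_of_notMem (fun h => ?_) _
      rw [Set.mem_singleton_iff.1 h] at hn
      exact hn.false
    have hG : ∀ n, n ≠ m → ctmcGenerator N.eventRate queueAct f n =
        ∑ e, N.eventRate e * f (queueAct e n) := fun n hn => by
      simp [ctmcGenerator, f, hn]
    have hnn : ∀ n, 0 ≤ (P n).toReal * ctmcGenerator N.eventRate queueAct f n := by
      intro n
      rcases eq_or_ne n m with rfl | hn
      · rw [hm, zero_mul]
      · rw [hG n hn]
        exact mul_nonneg ENNReal.toReal_nonneg
          (Finset.sum_nonneg fun e _ => mul_nonneg (N.eventRate_nonneg e) (hf0 _))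
    have hsum : Summable fun n => (P n).toReal * ctmcGenerator N.eventRate queueAct f n :=
      summable_weight_mul (b := fun _ => 1) (by simpa using P.hasSum_toReal.summable)
        (fun _ => ENNReal.toReal_nonneg) fun n =>
        (abs_ctmcGenerator_le N.eventRate_nonneg (abs_indicator_one_le {m}) n).trans_eq
          (mul_one _).symm
    have hzero := congr_fun ((hasSum_zero_iff_of_nonneg hnn).1 (hsum.hasSum_iff.2 hstat))
      (addPacket m y)
    have hne : addPacket m y ≠ m := fun h => by
      have := congr_fun h y
      simp at this
    have hpos : 0 < ctmcGenerator N.eventRate queueAct f (addPacket m y) := by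
      rw [hG _ hne]
      refine Finset.sum_pos' (fun e _ => mul_nonneg (N.eventRate_nonneg e) (hf0 _))
        ⟨Sum.inr (y, none), Finset.mem_univ _, ?_⟩
      simpa [queueAct, f, JacksonNetwork.eventRate] using mul_pos (N.service_pos y) (hleave y)
    exact (mul_eq_zero.1 hzero).resolve_right hpos.ne'
  have := P.hasSum_toReal
  simp only [hall] at this
  exact zero_ne_one (hasSum_zero.unique this)

/-- In a stable network with losses everywhere the total input is less than the total rate at
which packets can leave. -/
theorem JacksonNetwork.IsStable.sum_input_lt {N : JacksonNetwork V} [Nonempty V]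
    (hN : N.IsStable) (hleave : ∀ y, 0 < N.leave y) :
    ∑ x, N.input x < ∑ y, N.service y * N.leave y := by
  obtain ⟨P, hP⟩ := hN
  by_contra! hle
  have hout : 0 < ∑ y, N.service y * N.leave y :=
    Finset.sum_pos (fun y _ => mul_pos (N.service_pos y) (hleave y)) Finset.univ_nonempty
  set w := fun n => (P n).toReal
  have hw1 : Summable fun n => w n * 1 := by simpa using P.hasSum_toReal.summable
  have hw0 : ∀ n, 0 ≤ w n := fun n => ENNReal.toReal_nonneg
  -- Natural subtraction gives the positive part of `K - ∑ n`: it has finite support, and each event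
  -- changes it by at most one, so its generator is bounded uniformly in `K`.
  set f : ℕ → (V → ℕ) → ℝ := fun K n => ((K - ∑ i, n i : ℕ) : ℝ)
  set h : (V → ℕ) → ℝ := fun n =>
    -(∑ x, N.input x) + ∑ y, if n y = 0 then 0 else N.service y * N.leave y
  have hfd : ∀ K e n, |f K (queueAct e n) - f K n| ≤ 1 := by
    intro K e n
    obtain ⟨h1, h2⟩ := sum_queueAct_le e n
    rw [abs_sub_le_iff, sub_le_iff_le_add, sub_le_iff_le_add]
    constructor
    · have : K - ∑ i, queueAct e n i ≤ 1 + (K - ∑ i, n i) := by omega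
      simp only [f]
      exact_mod_cast this
    · have : K - ∑ i, n i ≤ 1 + (K - ∑ i, queueAct e n i) := by omega
      simp only [f]
      exact_mod_cast this
  have hbound : ∀ K n, |ctmcGenerator N.eventRate queueAct (f K) n| ≤ (∑ e, N.eventRate e) * 1 := by
    intro K n
    rw [Finset.sum_mul]
    refine (Finset.abs_sum_le_sum_abs _ _).trans (Finset.sum_le_sum fun e _ => ?_)
    rw [abs_mul, abs_of_nonneg (N.eventRate_nonneg e)]
    exact mul_le_mul_of_nonneg_left (hfd K e n) (N.eventRate_nonneg e)
  have hGf : ∀ K n, ∑ i, n i < K → ctmcGenerator N.eventRate queueAct (f K) n = h n := by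
    intro K n hK
    rw [N.ctmcGenerator_eventRate]
    have hin : ∀ x, f K (queueAct (Sum.inl x) n) - f K n = -1 := fun x => by
      have : K - ∑ i, n i = K - (∑ i, n i + 1) + 1 := by omega
      simp [f, queueAct, sum_addPacket, this]
    have hdep : ∀ y, f K (queueAct (Sum.inr (y, none)) n) - f K n = if n y = 0 then 0 else 1 := by
      intro y
      simp only [queueAct]
      split_ifs with hy
      · simp
      · have := sum_removePacket hy
        have : K - ∑ i, removePacket n y i = K - ∑ i, n i + 1 := by omega
        simp [f, this]
    have hfwd : ∀ y x, f K (queueAct (Sum.inr (y, some x)) n) - f K n = 0 := by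
      intro y x
      simp only [queueAct]
      split_ifs with hy
      · simp
      · simp [f, sum_addPacket, sum_removePacket hy]
    simp [hin, hdep, hfwd, h]
  have hlim : Tendsto (fun K => ∑' n, w n * ctmcGenerator N.eventRate queueAct (f K) n) atTop
      (𝓝 (∑' n, w n * h n)) := by
    refine tendsto_tsum_of_dominated_convergence (hw1.mul_right _) (fun n => ?_)
      (.of_forall fun K n => abs_weight_mul_le hw0 (hbound K) n)
    refine tendsto_const_nhds.congr' ?_
    filter_upwards [eventually_gt_atTop (∑ i, n i)] with K hK
    rw [hGf K n hK]
  have hzero : ∀ K, ∑' n, w n * ctmcGenerator N.eventRate queueAct (f K) n = 0 := fun K =>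
    hP.tsum_ctmcGenerator (K := K) fun n hn => by simp [f, Nat.sub_eq_zero_of_le hn.le]
  simp only [hzero] at hlim
  have hh0 := tendsto_nhds_unique hlim tendsto_const_nhds
  have hhle : ∀ n, w n * h n ≤ 0 := fun n => by
    refine mul_nonpos_of_nonneg_of_nonpos (hw0 n) ?_
    have : ∑ y, (if n y = 0 then 0 else N.service y * N.leave y) ≤
        ∑ y, N.service y * N.leave y := Finset.sum_le_sum fun y _ => by
      split_ifs
      · exact (mul_pos (N.service_pos y) (hleave y)).le
      · exact le_rfl
    simp only [h]
    linarith
  have hsum : Summable fun n => w n * h n := by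
    refine summable_weight_mul hw1 hw0 (C := (∑ e, N.eventRate e)) fun n => ?_
    rw [← hGf (∑ i, n i + 1) n (Nat.lt_succ_self _)]
    exact hbound _ n
  have hneg : HasSum (fun n => -(w n * h n)) 0 := by
    simpa [hh0] using hsum.hasSum.neg
  -- The drift `h` is nonpositive with mean zero, hence zero at the empty state, where it is minus
  -- the total input.
  have h00 := congr_fun ((hasSum_zero_iff_of_nonneg fun n => neg_nonneg.2 (hhle n)).1 hneg) 0
  have hwpos : 0 < w 0 := hP.toReal_zero_pos hleave
  have hin0 : 0 < ∑ x, N.input x := hout.trans_le hle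
  simp [h, hwpos.ne', hin0.ne'] at h00

end StableState

/-! ### Geometric product laws and their mean queue lengths. -/

/-- The geometric distribution on `ℕ` with ratio `ρ`. -/
def geometricPMF (ρ : ℝ) (h0 : 0 < ρ) (h1 : ρ < 1) : PMF ℕ :=
  ⟨fun k => ENNReal.ofReal ((1 - ρ) * ρ ^ k), by
    have h := (hasSum_geometric_of_lt_one h0.le h1).mul_left (1 - ρ)
    rw [mul_inv_cancel₀ (by linarith)] at h
    have h' := ENNReal.hasSum_coe.2 (h.toNNReal fun k => mul_nonneg (by linarith) (by positivity))
    simpa [ENNReal.ofReal] using h'⟩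

theorem geometricPMF_apply {ρ : ℝ} (h0 : 0 < ρ) (h1 : ρ < 1) (k : ℕ) :
    geometricPMF ρ h0 h1 k = ENNReal.ofReal ((1 - ρ) * ρ ^ k) := rfl

theorem geometricPMF_succ {ρ : ℝ} (h0 : 0 < ρ) (h1 : ρ < 1) (k : ℕ) :
    geometricPMF ρ h0 h1 (k + 1) = ENNReal.ofReal ρ * geometricPMF ρ h0 h1 k := by
  rw [geometricPMF_apply, geometricPMF_apply, ← ENNReal.ofReal_mul h0.le]
  congr 1
  ring

theorem geometricPMF_ne_zero {ρ : ℝ} (h0 : 0 < ρ) (h1 : ρ < 1) (k : ℕ) :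
    geometricPMF ρ h0 h1 k ≠ 0 := by
  have : 0 < 1 - ρ := by linarith
  rw [geometricPMF_apply, ENNReal.ofReal_ne_zero_iff]
  positivity

theorem tsum_geometricPMF_mul_ne_top {ρ : ℝ} (h0 : 0 < ρ) (h1 : ρ < 1) :
    ∑' k : ℕ, geometricPMF ρ h0 h1 k * (k : ℝ≥0∞) ≠ ∞ := by
  have h : Summable fun k : ℕ => (1 - ρ) * (k * ρ ^ k) := by
    have := summable_pow_mul_geometric_of_norm_lt_one 1
      (show ‖ρ‖ < 1 by rwa [Real.norm_of_nonneg h0.le])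
    simpa using this.mul_left (1 - ρ)
  convert h.tsum_ofReal_ne_top using 3 with k
  rw [geometricPMF_apply, ← ENNReal.ofReal_natCast, ← ENNReal.ofReal_mul
    (mul_nonneg (by linarith) (by positivity))]
  congr 1
  ring

section ProductGeometric

variable {V : Type*} [Fintype V]

/-- Independent geometric queue lengths. -/
def productGeometric (ρ : V → ℝ) (h0 : ∀ x, 0 < ρ x) (h1 : ∀ x, ρ x < 1) : PMF (V → ℕ) :=
  (Measure.pi fun x => (geometricPMF (ρ x) (h0 x) (h1 x)).toMeasure).toPMF

variable {ρ : V → ℝ} {h0 : ∀ x, 0 < ρ x} {h1 : ∀ x, ρ x < 1}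

theorem productGeometric_apply (n : V → ℕ) :
    productGeometric ρ h0 h1 n = ∏ x, geometricPMF (ρ x) (h0 x) (h1 x) (n x) := by
  rw [productGeometric, Measure.toPMF_apply, Measure.pi_singleton]
  simp [PMF.toMeasure_apply_singleton]

theorem productGeometric_ne_zero (n : V → ℕ) : productGeometric ρ h0 h1 n ≠ 0 := by
  rw [productGeometric_apply]
  exact Finset.prod_ne_zero_iff.2 fun x _ => geometricPMF_ne_zero _ _ _

theorem productGeometric_addPacket [DecidableEq V] (n : V → ℕ) (x : V) :
    productGeometric ρ h0 h1 (addPacket n x) =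
      ENNReal.ofReal (ρ x) * productGeometric ρ h0 h1 n := by
  rw [productGeometric_apply, productGeometric_apply,
    ← Finset.mul_prod_erase _ _ (Finset.mem_univ x),
    ← Finset.mul_prod_erase _ _ (Finset.mem_univ x), addPacket_same, geometricPMF_succ, mul_assoc]
  congr 2
  exact Finset.prod_congr rfl fun y hy => by rw [addPacket_of_ne n (Finset.ne_of_mem_erase hy)]

theorem meanQueue_productGeometric_ne_top (x : V) :
    meanQueue (productGeometric ρ h0 h1) x ≠ ∞ := by
  set μ : V → Measure ℕ := fun x => (geometricPMF (ρ x) (h0 x) (h1 x)).toMeasure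
  have h2 : meanQueue (productGeometric ρ h0 h1) x = ∫⁻ n, (n x : ℝ≥0∞) ∂Measure.pi μ := by
    rw [lintegral_countable', meanQueue]
    exact tsum_congr fun n => by rw [productGeometric, Measure.toPMF_apply, mul_comm]
  have h3 : ∫⁻ n, (n x : ℝ≥0∞) ∂Measure.pi μ = ∫⁻ k, (k : ℝ≥0∞) ∂μ x := by
    rw [← (measurePreserving_eval μ x).lintegral_comp measurable_from_nat]
  rw [h2, h3, lintegral_countable']
  simp only [μ, PMF.toMeasure_apply_singleton _ _ (MeasurableSet.singleton _)]
  simpa only [mul_comm] using tsum_geometricPMF_mul_ne_top (h0 x) (h1 x)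

end ProductGeometric

/-- Shifting a queue by one packet: the mean queue length `q` satisfies `q = ρ (q + 1)`. -/
theorem meanQueue_eq_of_productForm {V : Type*} [DecidableEq V] {P : PMF (V → ℕ)} {x : V} {r : ℝ≥0∞}
    (hP : ∀ n, P (addPacket n x) = r * P n) : meanQueue P x = r * (meanQueue P x + 1) := by
  have h : meanQueue P x = ∑' n, P (addPacket n x) * (addPacket n x x : ℝ≥0∞) := by
    -- The shift misses only states whose queue at `x` is empty, and these contribute nothing to the
    -- mean.
    refine ((addPacket_injective x).tsum_eq fun n hn => ?_).symm
    by_contra h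
    exact hn (by simp [apply_eq_zero_of_notMem_range_addPacket h])
  conv_lhs => rw [h]
  simp only [hP, addPacket_same, Nat.cast_add, Nat.cast_one, mul_add, mul_one, mul_assoc]
  rw [ENNReal.tsum_add, ENNReal.tsum_mul_left, ENNReal.tsum_mul_left, P.tsum_coe, mul_one]
  rfl

/-! ### Little's law by tagging packets. -/

section Little

variable {V : Type*} [DecidableEq V] [Fintype V]

/-- The sum of `f` over all the ways to tag one of the packets of `n`. -/
def packetSum (f : (V → ℕ) × Option (V × ℕ) → ℝ) (n : V → ℕ) : ℝ :=
  ∑ i, ∑ p ∈ Finset.range (n i), f (n, some (i, p))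

theorem sum_range_addPacket (h : V → ℕ → ℝ) (n : V → ℕ) (x : V) :
    ∑ i, ∑ p ∈ Finset.range (addPacket n x i), h i p =
      ∑ i, ∑ p ∈ Finset.range (n i), h i p + h x (n x) := by
  have hi : ∀ i, ∑ p ∈ Finset.range (addPacket n x i), h i p =
      ∑ p ∈ Finset.range (n i), h i p + if x = i then h i (n i) else 0 := by
    intro i
    by_cases hx : x = i
    · subst hx
      simp [Finset.sum_range_succ]
    · simp [hx, addPacket_of_ne n (Ne.symm hx)]
  simp [hi, Finset.sum_add_distrib]

/-- Position `0` is the packet being served, which contributes `c`; those behind it each move up by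
one and fill the positions of the shorter queue. -/
theorem sum_range_served (h : V → ℕ → ℝ) (n : V → ℕ) (y : V) (c : ℝ) :
    ∑ i, ∑ p ∈ Finset.range (addPacket n y i),
      (if y ≠ i then h i p else if p ≠ 0 then h i (p - 1) else c) =
      ∑ i, ∑ p ∈ Finset.range (n i), h i p + c := by
  have hi : ∀ i, ∑ p ∈ Finset.range (addPacket n y i),
      (if y ≠ i then h i p else if p ≠ 0 then h i (p - 1) else c) =
      ∑ p ∈ Finset.range (n i), h i p + if y = i then c else 0 := by
    intro i
    by_cases hy : y = i
    · subst hy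
      simp [Finset.sum_range_succ']
    · simp [hy, addPacket_of_ne n (Ne.symm hy)]
  simp only [hi, Finset.sum_add_distrib, Finset.sum_ite_eq, Finset.mem_univ, if_true]

/-- The new packet, last in the queue of `x`, is present after the event but was not there to be
tagged before it. -/
theorem packetSum_comp_arrival (f : (V → ℕ) × Option (V × ℕ) → ℝ) (n : V → ℕ) (x : V) :
    packetSum (fun s => f (taggedAct (Sum.inl x) s)) n =
      packetSum f (addPacket n x) - f (addPacket n x, some (x, n x)) := by
  simp only [packetSum, taggedAct, queueAct]
  rw [sum_range_addPacket (fun i p => f (addPacket n x, some (i, p))), add_sub_cancel_right]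

theorem packetSum_comp_service {f : (V → ℕ) × Option (V × ℕ) → ℝ} (hf : ∀ n, f (n, none) = 0)
    (n : V → ℕ) (y : V) (o : Option V) :
    packetSum (fun s => f (taggedAct (Sum.inr (y, o)) s)) n =
      packetSum f (queueAct (Sum.inr (y, o)) n) := by
  have hact : ∀ i p, f (taggedAct (Sum.inr (y, o)) (n, some (i, p))) =
      if y ≠ i then f (queueAct (Sum.inr (y, o)) n, some (i, p))
      else if p ≠ 0 then f (queueAct (Sum.inr (y, o)) n, some (i, p - 1))
      else f (queueAct (Sum.inr (y, o)) n, o.map fun x => (x, removePacket n y x)) := by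
    intro i p
    rw [taggedAct]
    split_ifs <;> rfl
  simp only [packetSum, hact]
  by_cases hy : n y = 0
  -- At an empty queue nothing moves, and no tag at `y` occurs in the sum, so the value of
  -- `taggedAct` on such tags is irrelevant.
  · have hq : queueAct (Sum.inr (y, o)) n = n := by cases o <;> simp [queueAct, hy]
    rw [hq]
    refine Finset.sum_congr rfl fun i _ => Finset.sum_congr rfl fun p hp => ?_
    rw [if_pos]
    rintro rfl
    simp [hy] at hp
  · obtain ⟨m, rfl⟩ : ∃ m, addPacket m y = n := ⟨_, addPacket_removePacket hy⟩
    rw [sum_range_served (fun i p => f (queueAct (Sum.inr (y, o)) (addPacket m y), some (i, p)))]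
    cases o with
    | none => simp [queueAct, hf]
    | some x =>
      simp [queueAct, sum_range_addPacket (fun i p => f (addPacket m x, some (i, p)))]

/-- Tagging one of the packets present commutes with the dynamics, up to the arrivals. -/
theorem JacksonNetwork.packetSum_ctmcGenerator (N : JacksonNetwork V)
    {f : (V → ℕ) × Option (V × ℕ) → ℝ} (hf : ∀ n, f (n, none) = 0) (n : V → ℕ) :
    packetSum (ctmcGenerator N.eventRate taggedAct f) n =
      ctmcGenerator N.eventRate queueAct (packetSum f) n -
        ∑ x, N.input x * f (addPacket n x, some (x, n x)) := by
  have h : packetSum (ctmcGenerator N.eventRate taggedAct f) n =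
      ∑ e, N.eventRate e * (packetSum (fun s => f (taggedAct e s)) n - packetSum f n) := by
    simp only [packetSum, ctmcGenerator, ← Finset.sum_sub_distrib, Finset.mul_sum]
    rw [Finset.sum_comm]
    exact Finset.sum_congr rfl fun i _ => Finset.sum_comm
  rw [h, ctmcGenerator, Fintype.sum_sum_type, Fintype.sum_sum_type, add_sub_right_comm,
    ← Finset.sum_sub_distrib]
  congr 1
  · refine Finset.sum_congr rfl fun x _ => ?_
    rw [packetSum_comp_arrival]
    simp only [queueAct, JacksonNetwork.eventRate]
    ring
  · exact Finset.sum_congr rfl fun e _ => by rw [packetSum_comp_service hf]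

omit [DecidableEq V] in
theorem abs_packetSum_le {f : (V → ℕ) × Option (V × ℕ) → ℝ} {C : ℝ} (hf : ∀ s, |f s| ≤ C)
    (n : V → ℕ) : |packetSum f n| ≤ C * ∑ i, (n i : ℝ) := by
  refine (Finset.abs_sum_le_sum_abs _ _).trans ?_
  rw [Finset.mul_sum]
  refine Finset.sum_le_sum fun i _ => (Finset.abs_sum_le_sum_abs _ _).trans ?_
  refine (Finset.sum_le_card_nsmul _ _ C fun p _ => hf _).trans_eq ?_
  rw [Finset.card_range, nsmul_eq_mul, mul_comm]

omit [DecidableEq V] in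
theorem hasDerivAt_packetSum {u : ℝ → (V → ℕ) × Option (V × ℕ) → ℝ}
    {u' : (V → ℕ) × Option (V × ℕ) → ℝ} {t : ℝ}
    (h : ∀ s, HasDerivAt (fun t => u t s) (u' s) t) (n : V → ℕ) :
    HasDerivAt (fun t => packetSum (u t) n) (packetSum u' n) t :=
  HasDerivAt.fun_sum fun _ _ => HasDerivAt.fun_sum fun _ _ => h _

/-- A packet that has left the network stays outside. -/
theorem ctmcSemigroup_taggedAct_none (rate : NetEvent V → ℝ)
    {f : (V → ℕ) × Option (V × ℕ) → ℝ} (hf : ∀ n, f (n, none) = 0) (t : ℝ) (n : V → ℕ) :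
    ctmcSemigroup rate taggedAct t f (n, none) = 0 := by
  have hact : ∀ (e : NetEvent V) n, taggedAct e (n, none) = (queueAct e n, none) := by
    rintro (x | ⟨y, o⟩) n <;> rfl
  have hk : ∀ k n, (ctmcGenerator rate taggedAct)^[k] f (n, none) = 0 := by
    intro k
    induction k with
    | zero => exact hf
    | succ k ih =>
      intro n
      rw [Function.iterate_succ_apply', ctmcGenerator]
      simp [hact, ih]
  simp [ctmcSemigroup, hk]

/-- Little's law for the stable state of product form. -/
theorem JacksonNetwork.meanLifetime_of_productForm (N : JacksonNetwork V) [Nonempty V]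
    (hin : ∀ x, 0 < N.input x) {ρ : V → ℝ} (hρ : ∀ x, 0 < ρ x)
    (hs : N.IsSiteTraffic fun x => N.service x * ρ x) {P : PMF (V → ℕ)} (hP : ∀ n, P n ≠ 0)
    (hw : ∀ n x, (P (addPacket n x)).toReal = ρ x * (P n).toReal)
    (hq : ∀ x, meanQueue P x ≠ ∞) :
    N.meanLifetime P =
      ENNReal.ofReal ((∑ x, (meanQueue P x).toReal) / ∑ x, N.input x) := by
  set w := fun n => (P n).toReal
  have hw0 : ∀ n, 0 ≤ w n := fun n => ENNReal.toReal_nonneg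
  have hwpos : ∀ n, 0 < w n := fun n => ENNReal.toReal_pos (hP n) (P.apply_ne_top n)
  have hwb : HasSum (fun n => w n * ∑ i, (n i : ℝ)) (∑ x, (meanQueue P x).toReal) := by
    have h : ∀ x, HasSum (fun n => w n * (n x : ℝ)) (meanQueue P x).toReal := by
      intro x
      have h1 := ENNReal.hasSum_toReal (hq x)
      rw [← ENNReal.tsum_toReal_eq fun n =>
        ENNReal.mul_ne_top (P.apply_ne_top n) (ENNReal.natCast_ne_top _)] at h1
      simpa [ENNReal.toReal_mul, meanQueue] using h1
    simpa only [Finset.mul_sum] using hasSum_sum fun x (_ : x ∈ Finset.univ) => h x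
  set f : (V → ℕ) × Option (V × ℕ) → ℝ := fun s => if s.2.isSome then 1 else 0 with hfdef
  have hf : ∀ s, |f s| ≤ 1 := fun s => by
    simp only [hfdef]
    split_ifs <;> simp
  have hf0 : ∀ s, 0 ≤ f s := fun s => by
    simp only [hfdef]
    split_ifs <;> simp
  set G := ctmcGenerator (S := (V → ℕ) × Option (V × ℕ)) N.eventRate taggedAct
  set u := fun t => ctmcSemigroup N.eventRate taggedAct t f
  have hunn : ∀ t ≥ 0, ∀ s, 0 ≤ u t s := fun t ht =>
    ctmcSemigroup_nonneg N.eventRate_nonneg hf ht hf0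
  have hu : ∀ t ≥ 0, ∀ s, |u t s| ≤ 1 := fun t ht =>
    abs_ctmcSemigroup_le N.eventRate_nonneg hf ht
  have hGu : ∀ t ≥ 0, ∀ s, |G (u t) s| ≤ _ := fun t ht =>
    abs_ctmcGenerator_le N.eventRate_nonneg (hu t ht)
  have hGGu : ∀ t ≥ 0, ∀ s, |G (G (u t)) s| ≤ _ := fun t ht =>
    abs_ctmcGenerator_le N.eventRate_nonneg (hGu t ht)
  set inflow : ℝ → (V → ℕ) → ℝ := fun t n =>
    ∑ x, N.input x * u t (addPacket n x, some (x, n x))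
  have hinnn : ∀ t ≥ 0, ∀ n, 0 ≤ inflow t n := fun t ht n =>
    Finset.sum_nonneg fun x _ => mul_nonneg (hin x).le (hunn t ht _)
  -- The untagged generator averages to zero even on `packetSum (u t)`, which grows linearly in the
  -- queue lengths, because the mean queues are finite.
  have hIsum : ∀ t ≥ 0, HasSum (fun n => w n * inflow t n)
      (-∑' n, w n * packetSum (G (u t)) n) := by
    intro t ht
    have h1 := N.hasSum_weight_mul_ctmcGenerator hρ hs hw (F := packetSum (u t))
      (summable_weight_mul hwb.summable hw0 (abs_packetSum_le (hu t ht)))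
    have h2 := h1.sub
      (summable_weight_mul hwb.summable hw0 (abs_packetSum_le (hGu t ht))).hasSum
    rw [zero_sub] at h2
    refine h2.congr_fun fun n => ?_
    simp only [G]
    rw [N.packetSum_ctmcGenerator fun n => ctmcSemigroup_taggedAct_none _ (fun n => by simp [f]) t n]
    ring
  have hd : ∀ t > 0, HasDerivAt (fun t => ∑' n, w n * packetSum (u t) n)
      (∑' n, w n * packetSum (G (u t)) n) t := fun t ht =>
    hasDerivAt_tsum_weight_mul hwb.summable hw0
      (fun t ht => abs_packetSum_le (hu t (le_of_lt ht)))
      (fun t _ => hasDerivAt_packetSum fun s => hasDerivAt_ctmcSemigroup hf s t)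
      (fun t ht => abs_packetSum_le (hGu t (le_of_lt ht))) ht
  have hdd : ∀ t > 0, HasDerivAt (fun t => ∑' n, w n * packetSum (G (u t)) n)
      (∑' n, w n * packetSum (G (G (u t))) n) t := fun t ht =>
    hasDerivAt_tsum_weight_mul hwb.summable hw0
      (fun t ht => abs_packetSum_le (hGu t (le_of_lt ht)))
      (fun t _ => hasDerivAt_packetSum fun s => hasDerivAt_ctmcGenerator_ctmcSemigroup hf s t)
      (fun t ht => abs_packetSum_le (hGGu t (le_of_lt ht))) ht
  obtain ⟨c, hc⟩ := exists_tendsto_of_deriv_nonpos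
    (fun t ht => tsum_nonneg fun n => mul_nonneg (hw0 n) (Finset.sum_nonneg fun i _ =>
      Finset.sum_nonneg fun p _ => hunn t (le_of_lt ht) (n, some (i, p)))) hd
    (fun t ht => neg_nonneg.1 ((hIsum t (le_of_lt ht)).nonneg fun n =>
      mul_nonneg (hw0 n) (hinnn t (le_of_lt ht) n)))
  have hI0 := (tendsto_deriv_zero_of_tendsto hc hd hdd fun t ht =>
    abs_tsum_weight_mul_le hwb.summable hw0 (abs_packetSum_le (hGGu t (le_of_lt ht)))).neg
  rw [neg_zero] at hI0
  -- The mean survival of newly arrived packets is minus the derivative of a convergent function, so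
  -- it vanishes, and with it every nonnegative term.
  have hlast : ∀ n x, Tendsto (fun t => u t (addPacket n x, some (x, n x))) atTop (𝓝 0) := by
    intro n x
    have hk : 0 < w n * N.input x := mul_pos (hwpos n) (hin x)
    have h1 := hI0.div_const (w n * N.input x)
    rw [zero_div] at h1
    refine squeeze_zero' ?_ ?_ h1
    · filter_upwards [eventually_ge_atTop 0] with t ht using hunn t ht _
    · filter_upwards [eventually_ge_atTop 0] with t ht
      rw [le_div_iff₀ hk, mul_comm, mul_assoc]
      refine le_trans (mul_le_mul_of_nonneg_left ?_ (hw0 n))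
        (le_hasSum (hIsum t ht) n fun n' _ => mul_nonneg (hw0 n') (hinnn t ht n'))
      exact Finset.single_le_sum (f := fun x => N.input x * u t (addPacket n x, some (x, n x)))
        (fun x _ => mul_nonneg (hin x).le (hunn t ht _)) (Finset.mem_univ x)
  -- Induction on arrivals: either the tagged packet was present before the last arrival, which does
  -- not affect its tag, or it is itself the last arrival.
  have hall : ∀ n i p, p < n i → Tendsto (fun t => u t (n, some (i, p))) atTop (𝓝 0) := by
    refine packet_induction (fun i p hp => absurd hp (Nat.not_lt_zero p)) fun n x hn i p hp => ?_
    by_cases hpi : p < n i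
    · exact tendsto_ctmcSemigroup_act_zero N.eventRate_nonneg hf hf0 (e := Sum.inl x) (hin x)
        (hn i p hpi)
    · obtain rfl : i = x := by
        by_contra h
        rw [addPacket_of_ne n h] at hp
        exact hpi hp
      obtain rfl : p = n i := by
        rw [addPacket_same] at hp
        omega
      exact hlast n i
  have hφ0 : Tendsto (fun t => ∑' n, w n * packetSum (u t) n) atTop (𝓝 0) := by
    have h := tendsto_tsum_of_dominated_convergence (hwb.summable.mul_right 1)
      (f := fun t n => w n * packetSum (u t) n) (g := fun _ => 0) (𝓕 := atTop)
      (fun n => by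
        have : Tendsto (fun t => packetSum (u t) n) atTop
            (𝓝 (∑ i, ∑ p ∈ Finset.range (n i), (0 : ℝ))) :=
          tendsto_finsetSum _ fun i _ => tendsto_finsetSum _ fun p hp =>
            hall n i p (Finset.mem_range.1 hp)
        simpa using this.const_mul (w n))
      (by
        filter_upwards [eventually_ge_atTop 0] with t ht n
        exact abs_weight_mul_le hw0 (abs_packetSum_le (hu t ht)) n)
    rwa [tsum_zero] at h
  have hcont : ContinuousOn (fun t => ∑' n, w n * packetSum (u t) n) (Set.Ici 0) :=
    continuousOn_tsum (fun n => (continuous_const.mul (continuous_iff_continuousAt.2 fun t =>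
      (hasDerivAt_packetSum (fun s => hasDerivAt_ctmcSemigroup hf s t) n).continuousAt)).continuousOn)
      (hwb.summable.mul_right 1)
      (fun n t ht => abs_weight_mul_le hw0 (abs_packetSum_le (hu t ht)) n)
  have hg := (hcont 0 Set.self_mem_Ici).neg
  have hgd : ∀ t ∈ Set.Ioi (0 : ℝ), HasDerivAt (fun t => -∑' n, w n * packetSum (u t) n)
      (∑' n, w n * inflow t n) t := fun t ht => by
    rw [(hIsum t (le_of_lt ht)).tsum_eq]
    exact (hd t ht).neg
  have hgnn : ∀ t ∈ Set.Ioi (0 : ℝ), 0 ≤ ∑' n, w n * inflow t n := fun t ht =>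
    tsum_nonneg fun n => mul_nonneg (hw0 n) (hinnn t (le_of_lt ht) n)
  have hg0 : Tendsto (fun t => -∑' n, w n * packetSum (u t) n) atTop (𝓝 0) := by
    simpa using hφ0.neg
  -- The integral of the inflow is the initial mean number of packets minus its limit, which is
  -- zero.
  have hint := integral_Ioi_of_hasDerivAt_of_nonneg hg hgd hgnn hg0
  have hintable := integrableOn_Ioi_deriv_of_nonneg hg hgd hgnn hg0
  have hval : ∫ t in Set.Ioi (0 : ℝ), ∑' n, w n * inflow t n = ∑ x, (meanQueue P x).toReal := by
    rw [hint, zero_sub, Pi.neg_apply, neg_neg, ← hwb.tsum_eq]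
    refine tsum_congr fun n => ?_
    simp [u, ctmcSemigroup_zero, packetSum, f]
  have hin0 : 0 < ∑ x, N.input x := Finset.sum_pos (fun x _ => hin x) Finset.univ_nonempty
  have hlt : ∀ t ∈ Set.Ioi (0 : ℝ), (∑' n : V → ℕ, P n *
      ∑ x, ENNReal.ofReal (N.input x / ∑ y, N.input y) * ENNReal.ofReal (N.lifetimeTail n x t)) =
      ENNReal.ofReal ((∑' n, w n * inflow t n) / ∑ y, N.input y) := by
    intro t ht
    have ht0 : 0 ≤ t := le_of_lt ht
    rw [← tsum_div_const, ENNReal.ofReal_tsum_of_nonneg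
      (fun n => div_nonneg (mul_nonneg (hw0 n) (hinnn t ht0 n)) hin0.le)
      ((hIsum t ht0).summable.div_const _)]
    refine tsum_congr fun n => ?_
    rw [mul_div_assoc, ENNReal.ofReal_mul (hw0 n), ENNReal.ofReal_toReal (P.apply_ne_top n),
      Finset.sum_div, ENNReal.ofReal_sum_of_nonneg fun x _ =>
        div_nonneg (mul_nonneg (hin x).le (hunn t ht0 _)) hin0.le]
    congr 1
    refine Finset.sum_congr rfl fun x _ => ?_
    rw [mul_div_right_comm, ENNReal.ofReal_mul (div_nonneg (hin x).le hin0.le)]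
    rfl
  rw [JacksonNetwork.meanLifetime, setLIntegral_congr_fun measurableSet_Ioi hlt,
    ← ofReal_integral_eq_lintegral_ofReal (hintable.div_const _)
      ((ae_restrict_iff' measurableSet_Ioi).2 (.of_forall fun t ht =>
        div_nonneg (hgnn t ht) hin0.le)), integral_div, hval]

end Little

/-! ### Homogeneous routing on the lattice and the mean-field relation. -/

namespace LatticeModel

variable {d L : ℕ} [NeZero L]

theorem hopCost_const (M : LatticeModel d L) (c : ℝ≥0∞) (z : Site d L) (k : ℕ) (x : Site d L) :
    M.hopCost (fun _ => c) z k x = c * M.hopCost (fun _ => 1) z k x := by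
  induction k generalizing x with
  | zero => simp [hopCost]
  | succ k ih =>
    simp only [hopCost]
    split_ifs
    · simp
    · simp only [ih, ← Finset.mul_sum, mul_add, mul_one, div_eq_mul_inv, mul_assoc]

theorem meanRouteCost_const (M : LatticeModel d L) (c : ℝ≥0∞) :
    M.meanRouteCost (fun _ => c) = c * M.freeDelay := by
  simp only [freeDelay, meanRouteCost, M.hopCost_const c, ← ENNReal.mul_iSup, ← Finset.mul_sum,
    mul_div_assoc]

end LatticeModel

namespace Routing

variable {V : Type*} [Fintype V] {R : Routing V} {r : ℝ}

/-- With uniform losses and doubly balanced routing, the site traffic is uniform. -/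
theorem isSiteTraffic_network_iff (hr : 0 < r) (hleave : ∀ y, R.leave y = r)
    (hcol : ∀ x, ∑ y, R.route y x = 1 - r) {lam : ℝ} (hlam : 0 < lam) (s : V → ℝ) :
    (R.network lam hlam).IsSiteTraffic s ↔ ∀ x, s x = lam / r := by
  have hconst : lam / r = lam + lam / r * (1 - r) := by
    field_simp
    ring
  constructor
  · intro h
    set δ := fun x => s x - lam / r
    have hδ : ∀ x, δ x = ∑ y, δ y * R.route y x := by
      intro x
      have h1 : s x = lam + ∑ y, s y * R.route y x := h x
      simp only [δ, sub_mul, Finset.sum_sub_distrib, ← Finset.mul_sum, hcol]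
      linarith
    -- The difference from the constant solution solves the homogeneous equations, on which routing
    -- is an l¹ contraction by `1 - r`.
    have hsum : ∑ x, |δ x| ≤ (1 - r) * ∑ x, |δ x| := calc
      ∑ x, |δ x| ≤ ∑ x, ∑ y, |δ y| * R.route y x := Finset.sum_le_sum fun x _ => by
        rw [hδ x]
        refine (Finset.abs_sum_le_sum_abs _ _).trans_eq (Finset.sum_congr rfl fun y _ => ?_)
        rw [abs_mul, abs_of_nonneg (R.route_nonneg y x)]
      _ = (1 - r) * ∑ x, |δ x| := by
        rw [Finset.sum_comm, Finset.mul_sum]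
        refine Finset.sum_congr rfl fun y _ => ?_
        rw [← Finset.mul_sum, R.sum_route, hleave, mul_comm]
    have h0 : ∑ x, |δ x| = 0 :=
      le_antisymm (by nlinarith) (Finset.sum_nonneg fun _ _ => abs_nonneg _)
    intro x
    have := (Finset.sum_eq_zero_iff_of_nonneg fun _ _ => abs_nonneg _).1 h0 x (Finset.mem_univ x)
    exact sub_eq_zero.1 (abs_eq_zero.1 this)
  · intro h x
    change s x = lam + ∑ y, s y * R.route y x
    simp only [h, ← Finset.mul_sum, hcol]
    exact hconst

variable [DecidableEq V] [Nonempty V]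

/-- Below capacity, the network with uniform traffic has a stable state in which all mean queue
lengths are equal, and its mean lifetime is given by Little's law. -/
theorem exists_isStableState (hr : 0 < r) (hleave : ∀ y, R.leave y = r)
    (hcol : ∀ x, ∑ y, R.route y x = 1 - r) {lam : ℝ} (hlam : 0 < lam) (hlt : lam < r) :
    ∃ P : PMF (V → ℕ), (R.network lam hlam).IsStableState P ∧
      (∀ x, meanQueue P x = ENNReal.ofReal (lam / (r - lam))) ∧
      (R.network lam hlam).meanLifetime P = ENNReal.ofReal (1 / (r - lam)) := by
  have hρ0 : 0 < lam / r := div_pos hlam hr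
  have hρ1 : lam / r < 1 := (div_lt_one hr).2 hlt
  have hd : 0 < r - lam := sub_pos.2 hlt
  have hs : (R.network lam hlam).IsSiteTraffic
      fun x => (R.network lam hlam).service x * (lam / r) :=
    (isSiteTraffic_network_iff hr hleave hcol hlam _).2 fun x => one_mul _
  set P := productGeometric (fun _ : V => lam / r) (fun _ => hρ0) (fun _ => hρ1)
  have hP : ∀ n, P n ≠ 0 := productGeometric_ne_zero
  have hw : ∀ n x, (P (addPacket n x)).toReal = lam / r * (P n).toReal := fun n x => by
    rw [productGeometric_addPacket, ENNReal.toReal_mul, ENNReal.toReal_ofReal hρ0.le]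
  have hq : ∀ x, meanQueue P x ≠ ∞ := meanQueue_productGeometric_ne_top
  -- The relation `q = ρ (q + 1)` is also satisfied by `q = ∞`; the finiteness `hq` selects the real
  -- solution.
  have hqr : ∀ x, (meanQueue P x).toReal = lam / (r - lam) := fun x => by
    have h := congrArg ENNReal.toReal
      (meanQueue_eq_of_productForm (P := P) (x := x) fun n => productGeometric_addPacket n x)
    rw [ENNReal.toReal_mul, ENNReal.toReal_add (hq x) ENNReal.one_ne_top,
      ENNReal.toReal_ofReal hρ0.le, ENNReal.toReal_one] at h
    field_simp at h ⊢
    linarith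
  refine ⟨P, JacksonNetwork.isStableState_of_productForm _ (fun _ => hlam) (fun _ => hρ0) hs hP hw,
    fun x => by rw [← hqr x, ENNReal.ofReal_toReal (hq x)], ?_⟩
  rw [JacksonNetwork.meanLifetime_of_productForm _ (fun _ => hlam) (fun _ => hρ0) hs hP hw hq]
  congr 1
  have hV : (Fintype.card V : ℝ) ≠ 0 := Nat.cast_ne_zero.2 Fintype.card_ne_zero
  simp only [hqr, network, Finset.sum_const, Finset.card_univ, nsmul_eq_mul]
  field_simp

theorem isStable_network_iff (hr : 0 < r) (hleave : ∀ y, R.leave y = r)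
    (hcol : ∀ x, ∑ y, R.route y x = 1 - r) {lam : ℝ} (hlam : 0 < lam) :
    (R.network lam hlam).IsStable ↔ lam < r := by
  constructor
  · intro h
    have h1 := h.sum_input_lt fun y => hr.trans_eq (hleave y).symm
    simp only [network, hleave, Finset.sum_const, Finset.card_univ, nsmul_eq_mul, one_mul] at h1
    exact lt_of_mul_lt_mul_left h1 (Nat.cast_nonneg _)
  · intro h
    obtain ⟨P, hP, -⟩ := exists_isStableState hr hleave hcol hlam h
    exact ⟨P, hP⟩

end Routing

/-- A column has `degree` equal nonzero slots, because each site is a neighbour of as many sites as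
it has neighbours. -/
theorem LatticeModel.sum_route_of_isIsotropic {d L : ℕ} [NeZero L] (M : LatticeModel d L)
    {R : Routing (Site d L)} {r : ℝ} (hiso : R.IsIsotropic M.nbhd) (hhom : R.IsHomogeneous r)
    (x : Site d L) : ∑ y, R.route y x = 1 - r := by
  have h : ∀ y, R.route y x = if x ∈ M.nbhd y then 1 / (M.degree : ℝ) * (1 - r) else 0 := by
    intro y
    split_ifs with hx
    · rw [(hiso y x).1 hx, M.card_nbhd, hhom y]
    · exact (hiso y x).2 hx
  have hdeg : (M.degree : ℝ) ≠ 0 := Nat.cast_ne_zero.2 M.degree_pos.ne'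
  simp only [h]
  rw [← Finset.sum_filter, Finset.sum_const, M.card_inNbhd, nsmul_eq_mul]
  field_simp

theorem corollary1 {d L : ℕ} [NeZero L] (M : LatticeModel d L)
    (R : Routing (Site d L)) (rInf : ℝ) (hopen : 0 < rInf)
    (hiso : R.IsIsotropic M.nbhd) (hhom : R.IsHomogeneous rInf)
    (hlife : ∀ (lam : ℝ) (hlam : 0 < lam) (P : PMF (Site d L → ℕ)),
      (R.network lam hlam).IsStableState P → M.MeanFieldLifetime (R.network lam hlam) P) :
    rInf = 1 / M.freeDelay.toReal ∧
    (∀ (lam : ℝ) (hlam : 0 < lam) (s : Site d L → ℝ),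
      (R.network lam hlam).IsSiteTraffic s ↔ ∀ x, s x = lam * M.freeDelay.toReal) ∧
    (∀ (lam : ℝ) (hlam : 0 < lam),
      (R.network lam hlam).IsStable ↔ lam < 1 / M.freeDelay.toReal) ∧
    IsLUB R.stableTraffics (1 / M.freeDelay.toReal) := by
  have hcol := M.sum_route_of_isIsotropic hiso hhom
  have hdelay : M.freeDelay.toReal = 1 / rInf := by
    -- One stable traffic suffices to determine the free delay. At `rInf / 2` the mean queue length
    -- is one, and the relation reads `2 / rInf = 2 * freeDelay`.
    have hlam : 0 < rInf / 2 := half_pos hopen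
    obtain ⟨P, hP, hq, hT⟩ :=
      Routing.exists_isStableState hopen hhom hcol hlam (half_lt_self hopen)
    have h : ENNReal.ofReal (1 / (rInf - rInf / 2)) =
        (1 + ENNReal.ofReal (rInf / 2 / (rInf - rInf / 2))) * M.freeDelay := by
      rw [← M.meanRouteCost_const, ← hT, hlife _ hlam P hP]
      simp only [hq]
    have h' := congrArg ENNReal.toReal h
    have hne : rInf / 2 ≠ 0 := hlam.ne'
    rw [sub_half, div_self hne, ENNReal.toReal_mul, ENNReal.ofReal_one,
      ENNReal.toReal_add ENNReal.one_ne_top ENNReal.one_ne_top, ENNReal.toReal_one,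
      ENNReal.toReal_ofReal (by positivity)] at h'
    field_simp at h' ⊢
    linarith
  rw [hdelay, one_div_one_div]
  refine ⟨rfl, fun lam hlam s => ?_, fun lam hlam => ?_, ?_⟩
  · rw [Routing.isSiteTraffic_network_iff hopen hhom hcol hlam, mul_one_div]
  · exact Routing.isStable_network_iff hopen hhom hcol hlam
  · have hset : R.stableTraffics = Set.Ioo 0 rInf := by
      ext lam
      constructor
      · rintro ⟨hlam, h⟩
        exact ⟨hlam, (Routing.isStable_network_iff hopen hhom hcol hlam).1 h⟩
      · rintro ⟨hlam, h⟩
        exact ⟨hlam, (Routing.isStable_network_iff hopen hhom hcol hlam).2 h⟩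
    rw [hset]
    exact isLUB_Ioo hopen

end
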